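/- **Setting.** Let $n\ge1$, $N\ge2$, and let $\mathcal G=(\mathcal V,\mathcal E)$ be a connected undirected graph on $\mathcal V=\{1,\dots,N\}$, with neighbor sets $\mathcal N_i$ and Laplacian $L_{\mathcal G}$, whose second smallest and largest eigenvalues are $\lambda_2(L_{\mathcal G})$ and $\lambda_{\max}(L_{\mathcal G})$. For each $i$ let $f_i:\mathbb R^n\to\mathbb R$ be twice continuously differentiable and locally strongly convex (for every convex compact set $\mathcal C$ there is $c>0$ with $\nabla^2f_i\succeq cI_n$ on $\mathcal C$), have a minimizer $x_i^0$, and have a Hessian that is Lipschitz on every compact set. Let $x^*$ be the minimizer of $\sum_i f_i$, put $D_i(x)=f_i(x^*)-f_i(x)-\nabla f_i(x)^T(x^*-x)$, and assume that each $D_i$ is coercive. For stacked vectors $\mathbf x=[x_1;\dots;x_N]\in\mathbb R^{nN}$ let $V(\mathbf x)=\sum_i D_i(x_i)$; write $\mathbf x^0=[x_1^0;\dots;x_N^0]$, $\mathbf x^*=[x^*;\dots;x^*]$, $V_0=V(\mathbf x^0)$, and $\mathcal C_i=\{x: D_i(x)\le V_0\}$. **Constants.** Let $\theta_i,\Theta_i>0$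 and $L_i\ge0$ be such that $\theta_iI_n\preceq\nabla^2f_i\preceq\Theta_iI_n$ and $\nabla^2f_i$ is $L_i$-Lipschitz (spectral norm) on $\operatorname{conv}\mathcal C_i$; let $\theta=\min_i\theta_i$, $\Theta=\max_i\Theta_i$; let $\bar\theta_i>0$ be such that $\nabla^2 f_i\succeq\bar\theta_iI_n$ on $\operatorname{conv}\bigcup_j\mathcal C_j$. Fix $\bar\alpha>0$, let $\delta_i=\frac{\bar\alpha}{\theta_i}\sum_{j\in\mathcal N_i}\big(\sqrt{2V_0/\theta_i}+\sqrt{2V_0/\theta_j}\big)$ and $\mathcal C_i'=\operatorname{conv}\{x:\|x-y\|\le\delta_i\text{ for some }y\in\mathcal C_i\}$, and let $0<\theta_i'\le\theta_i$, $\Theta_i'\ge\Theta_i$, $L_i'\ge L_i$ be such that $\theta_i'I_n\preceq\nabla^2f_i\preceq\Theta_i'I_n$ and $\nabla^2f_i$ is $L_i'$-Lipschitz on $\mathcal C_i'$. **Algorithm.** For step sizes $\alpha_{\{i,j\}}$, $\{i,j\}\in\mathcal E$, and $g_{\{i,j\}}(x)=\frac12x^Tx$, let $\mathbf x^k$ be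 generated from $\mathbf x^0$ by $$x_i^{k+1}=x_i^k+(\nabla^2f_i(x_i^k))^{-1}\sum_{j\in\mathcal N_i}\alpha_{\{i,j\}}\big(\nabla g_{\{i,j\}}(x_j^k)-\nabla g_{\{i,j\}}(x_i^k)\big).$$ **Theorem.** (a) Suppose that for all $\{i,j\}\in\mathcal E$: $0<\alpha_{\{i,j\}}\le\bar\alpha$, $\alpha_{\{i,j\}}<\theta/\max_{l}|\mathcal N_l|$, and $$\alpha_{\{i,j\}}<\frac12\min_{l\in\{i,j\}}\frac{\theta_l^2}{|\mathcal N_l|}\Big(\Theta_l'-\frac{\theta_l'}2+\frac{L_l'}2\sqrt{\frac{2V_0}{\theta_l}}\Big)^{-1}.$$ Let $$q=\max\Big\{\frac{\max_{\mathcal E}\alpha_{\{i,j\}}\,\lambda_{\max}(L_{\mathcal G})}{\theta}-1,\;1-\frac{\min_{\mathcal E}\alpha_{\{i,j\}}\,\lambda_2(L_{\mathcal G})}{\Theta}\Big\}.$$ Then $q\in[0,1)$, and $q>0$ except possibly when $\mathcal G$ is complete, $\theta=\Theta$ and all $\alpha_{\{i,j\}}$ equal $\theta/N$. Moreover $$\tilde\rho_i=\frac{\theta_i^2}{2|\mathcal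 N_i|\max_{j\in\mathcal N_i}\alpha_{\{i,j\}}}+\frac{\theta_i}2-\Theta_i-\frac{L_i}2\sqrt{\frac{2V_0}{\theta_i}}>0\quad\text{for all }i,$$ and there is $\tilde{\mathbf x}=[\tilde x;\dots;\tilde x]$, $\tilde x\in\mathbb R^n$, such that for all $k\ge0$ $$\|\mathbf x^k-\tilde{\mathbf x}\|\le\frac{\max_{\mathcal E}\alpha_{\{i,j\}}\,\lambda_{\max}(L_{\mathcal G})}{\theta(1-q)}\,\|\mathbf x^0\|\,q^k,\qquad \|\tilde{\mathbf x}-\mathbf x^*\|\le\max_i\frac{L_i}{\tilde\rho_i}\cdot\frac{\sqrt N\,V_0}{2\sum_i\bar\theta_i}$$ (with $0^0=1$). (b) The last bound is $O(\max_{\mathcal E}\alpha_{\{i,j\}})$ as the step sizes tend to $0$: there are $C,\alpha_0>0$, independent of the step sizes, such that it is at most $C\max_{\mathcal E}\alpha_{\{i,j\}}$ whenever $0<\alpha_{\{i,j\}}\le\alpha_0$ for all $\{i,j\}\in\mathcal E$. -/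

import Mathlib

noncomputable section

namespace DEAN

/-- `ℝⁿ` with the Euclidean norm. -/
abbrev E (n : ℕ) : Type := EuclideanSpace ℝ (Fin n)

/-- `ℝ^{nN}`, seen as stacked vectors `[z₁; …; z_N]` with `z_i ∈ ℝⁿ`; the norm is the Euclidean
norm `√(∑ ‖z_i‖²)`. -/
abbrev Stack (N n : ℕ) : Type := PiLp 2 (fun _ : Fin N => E n)

/-- The consensus vector `[z; …; z]`. -/
def consensus (N : ℕ) {n : ℕ} (z : E n) : Stack N n := WithLp.toLp 2 (fun _ => z)

/-- The Hessian of `f` at `x`, as a linear operator (the derivative of the gradient). -/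
def hess {n : ℕ} (f : E n → ℝ) (x : E n) : E n →L[ℝ] E n := fderiv ℝ (gradient f) x

/-- `∇²f(x) ⪰ c I` for all `x ∈ S`. -/
def HessLowerBound {n : ℕ} (f : E n → ℝ) (S : Set (E n)) (c : ℝ) : Prop :=
  ∀ x ∈ S, ∀ v : E n, c * ‖v‖ ^ 2 ≤ inner ℝ v (hess f x v)

/-- `C I ⪰ ∇²f(x)` for all `x ∈ S`. -/
def HessUpperBound {n : ℕ} (f : E n → ℝ) (S : Set (E n)) (C : ℝ) : Prop :=
  ∀ x ∈ S, ∀ v : E n, inner ℝ v (hess f x v) ≤ C * ‖v‖ ^ 2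

/-- `∇²f` is Lipschitz on `S` with constant `L` (spectral norm). -/
def HessLipschitz {n : ℕ} (f : E n → ℝ) (S : Set (E n)) (L : ℝ) : Prop :=
  ∀ x ∈ S, ∀ y ∈ S, ‖hess f x - hess f y‖ ≤ L * ‖x - y‖

/-- Local strong convexity: a positive convexity parameter on every convex compact set. -/
def LocallyStronglyConvex {n : ℕ} (f : E n → ℝ) : Prop :=
  ∀ S : Set (E n), Convex ℝ S → IsCompact S → ∃ c > 0, HessLowerBound f S c

/-- Local Lipschitz continuity of the Hessian: a Lipschitz constant on every compact set. -/
def LocallyLipschitzHess {n : ℕ} (f : E n → ℝ) : Prop :=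
  ∀ S : Set (E n), IsCompact S → ∃ L ≥ 0, HessLipschitz f S L

/-- The standing assumption on a local objective: twice continuously differentiable, locally
strongly convex, with a minimizer and a locally Lipschitz Hessian. -/
structure ObjectiveAssumption {n : ℕ} (f : E n → ℝ) : Prop where
  contDiff : ContDiff ℝ 2 f
  stronglyConvex : LocallyStronglyConvex f
  hasMinimizer : ∃ x, IsMinOn f Set.univ x
  lipschitzHess : LocallyLipschitzHess f

/-- `f(y) - f(x) - ∇f(x)ᵀ(y - x)`. -/
def bregman {n : ℕ} (f : E n → ℝ) (y x : E n) : ℝ :=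
  f y - f x - inner ℝ (gradient f x) (y - x)

/-- The Lyapunov function `V(𝐱) = ∑ᵢ f_i(x*) - f_i(x_i) - ∇f_i(x_i)ᵀ(x* - x_i)`. -/
def V {N n : ℕ} (f : Fin N → E n → ℝ) (xs : E n) (x : Stack N n) : ℝ :=
  ∑ i, bregman (f i) xs (x i)

/-- The sublevel set `C_i`. -/
def Cset {N n : ℕ} (f : Fin N → E n → ℝ) (xs : E n) (x0 : Stack N n) (i : Fin N) : Set (E n) :=
  {x | bregman (f i) xs x ≤ V f xs x0}

/-- One DEAN update, with surrogate functions `g_{i,j}` and step sizes `α_{i,j}` attached to the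
links: `x_i ↦ x_i + (∇²f_i(x_i))⁻¹ ∑_{j ∈ N_i} α_{i,j} (∇g_{i,j}(x_j) - ∇g_{i,j}(x_i))`. -/
def step {N n : ℕ} (G : SimpleGraph (Fin N)) [DecidableRel G.Adj] (f : Fin N → E n → ℝ)
    (g : Sym2 (Fin N) → E n → ℝ) (α : Sym2 (Fin N) → ℝ) (x : Stack N n) : Stack N n :=
  WithLp.toLp 2 fun i => x i + (hess (f i) (x i)).inverse
    (∑ j ∈ G.neighborFinset i,
      α s(i, j) • (gradient (g s(i, j)) (x j) - gradient (g s(i, j)) (x i)))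

/-- The DEAN iterates started at `x0`. -/
def iterate {N n : ℕ} (G : SimpleGraph (Fin N)) [DecidableRel G.Adj] (f : Fin N → E n → ℝ)
    (g : Sym2 (Fin N) → E n → ℝ) (α : Sym2 (Fin N) → ℝ) (x0 : Stack N n) : ℕ → Stack N n
  | 0 => x0
  | k + 1 => step G f g α (iterate G f g α x0 k)

/-- The surrogate functions `g_{i,j}(x) = ½ xᵀx`. -/
def quadSurrogate (N n : ℕ) : Sym2 (Fin N) → E n → ℝ := fun _ x => (1 / 2) * inner ℝ x x

/-- The radius `δ_i`; `v0` stands for `V(𝐱⁰)`, and `Γ_{i,j} = 1`, which is the Lipschitz constant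
of the gradient of `½ xᵀx`. -/
def delta {N : ℕ} (G : SimpleGraph (Fin N)) [DecidableRel G.Adj] (αbar v0 : ℝ) (θ : Fin N → ℝ)
    (i : Fin N) : ℝ :=
  αbar / θ i * ∑ j ∈ G.neighborFinset i, (√(2 * v0 / θ i) + √(2 * v0 / θ j))

/-- The enlarged set `C'_i = conv {x : ‖x - y‖ ≤ δ_i for some y ∈ C_i}`. -/
def Cset' {N n : ℕ} (G : SimpleGraph (Fin N)) [DecidableRel G.Adj] (f : Fin N → E n → ℝ)
    (xs : E n) (x0 : Stack N n) (αbar : ℝ) (θ : Fin N → ℝ) (i : Fin N) : Set (E n) :=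
  convexHull ℝ {x | ∃ y ∈ Cset f xs x0 i, ‖x - y‖ ≤ delta G αbar (V f xs x0) θ i}

/-- `(θ_i² / |N_i|) (Θ'_i - θ'_i / 2 + (L'_i / 2) √(2 V(𝐱⁰) / θ_i))⁻¹`. -/
def stepTerm {N : ℕ} (G : SimpleGraph (Fin N)) [DecidableRel G.Adj] (v0 : ℝ)
    (θ θ' Θ' L' : Fin N → ℝ) (i : Fin N) : ℝ :=
  θ i ^ 2 / (G.degree i : ℝ) * (Θ' i - θ' i / 2 + L' i / 2 * √(2 * v0 / θ i))⁻¹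

/-- The step-size condition (with `Γ_{i,j} = 1`) that makes the Lyapunov function decrease. -/
def StepSizeDrop {N : ℕ} (G : SimpleGraph (Fin N)) [DecidableRel G.Adj] (v0 : ℝ)
    (θ θ' Θ' L' : Fin N → ℝ) (α : Sym2 (Fin N) → ℝ) : Prop :=
  ∀ i j, G.Adj i j →
    α s(i, j) < 1 / 2 * min (stepTerm G v0 θ θ' Θ' L' i) (stepTerm G v0 θ θ' Θ' L' j)

/-- The `k`-th smallest eigenvalue of a symmetric matrix, counted with multiplicity and starting
from `k = 0` (Mathlib lists the eigenvalues in decreasing order). -/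
def eigAsc {N : ℕ} {A : Matrix (Fin N) (Fin N) ℝ} (hA : A.IsHermitian) (k : Fin N) : ℝ :=
  hA.eigenvalues₀ (Fin.cast (Fintype.card_fin N).symm k.rev)

/-- `λ₂` of the graph Laplacian. -/
def lam2 {N : ℕ} (hN : 2 ≤ N) (G : SimpleGraph (Fin N)) [DecidableRel G.Adj] : ℝ :=
  eigAsc (G.isHermitian_lapMatrix (R := ℝ)) ⟨1, by omega⟩

/-- `λ_max` of the graph Laplacian. -/
def lamMax {N : ℕ} (hN : 2 ≤ N) (G : SimpleGraph (Fin N)) [DecidableRel G.Adj] : ℝ :=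
  eigAsc (G.isHermitian_lapMatrix (R := ℝ)) ⟨N - 1, by omega⟩

/-- The largest step size over the links. -/
def alphaMax {N : ℕ} (G : SimpleGraph (Fin N)) (α : Sym2 (Fin N) → ℝ) : ℝ :=
  ⨆ e : G.edgeSet, α e

/-- The smallest step size over the links. -/
def alphaMin {N : ℕ} (G : SimpleGraph (Fin N)) (α : Sym2 (Fin N) → ℝ) : ℝ :=
  ⨅ e : G.edgeSet, α e

/-- The rate `q = max {max α · λ_max / θ - 1, 1 - min α · λ₂ / Θ}`, where `θ = min θ_i` and
`Θ = max Θ_i`. -/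
def rate {N : ℕ} (hN : 2 ≤ N) (G : SimpleGraph (Fin N)) [DecidableRel G.Adj]
    (θ Θ : Fin N → ℝ) (α : Sym2 (Fin N) → ℝ) : ℝ :=
  max (alphaMax G α * lamMax hN G / (⨅ i, θ i) - 1) (1 - alphaMin G α * lam2 hN G / (⨆ i, Θ i))

/-- `ρ̃_i = θ_i² / (2 |N_i| max_{j ∈ N_i} α_{i,j}) + θ_i / 2 - Θ_i - (L_i / 2) √(2 V(𝐱⁰) / θ_i)`. -/
def rho {N : ℕ} (G : SimpleGraph (Fin N)) [DecidableRel G.Adj] (v0 : ℝ) (θ Θ L : Fin N → ℝ)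
    (α : Sym2 (Fin N) → ℝ) (i : Fin N) : ℝ :=
  θ i ^ 2 / (2 * (G.degree i : ℝ) * ⨆ j : G.neighborSet i, α s(i, (j : Fin N)))
    + θ i / 2 - Θ i - L i / 2 * √(2 * v0 / θ i)

/-- The bound `max_i (L_i / ρ̃_i) · √N V(𝐱⁰) / (2 ∑ᵢ θ̄_i)` on the optimality error. -/
def errorBound {N : ℕ} (G : SimpleGraph (Fin N)) [DecidableRel G.Adj] (v0 : ℝ)
    (θ Θ L θbar : Fin N → ℝ) (α : Sym2 (Fin N) → ℝ) : ℝ :=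
  (⨆ i, L i / rho G v0 θ Θ L α i) * (√(N : ℝ) * v0 / (2 * ∑ i, θbar i))

end DEAN

end

/-!
An update of the algorithm is a preconditioned Richardson step `x - H⁻¹ L_α x` for the weighted
Laplacian `L_α`, where `H` is block-diagonal with the Hessians as blocks and satisfies
`θ ≤ H ≤ Θ`. Hence `1 - H⁻¹ L_α` is self-adjoint for the energy `⟨x, L_α x⟩`, which it contracts by
`q²`, and the iterates converge geometrically to a consensus vector.

What keeps the Hessians within these bounds is the Lyapunov function `V`: a second-order expansion
gives `V(xᵏ⁺¹) + ∑ ρ̃_i ‖x_iᵏ⁺¹ - x_iᵏ‖² ≤ V(xᵏ)`, so the iterates stay in the sublevel sets `C_i`.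
The same decrease controls the limit. The sum of the local gradients starts at zero, and its
first-order variation vanishes in every step because the columns of `L_α` sum to zero, so that it
moves by at most `∑ (L_i / 2) ‖x_iᵏ⁺¹ - x_iᵏ‖² ≤ max (L_i / ρ̃_i) / 2 · (V(xᵏ) - V(xᵏ⁺¹))`.
Summing over `k`, the gradient of `∑ f_i` at the limit is at most `max (L_i / ρ̃_i) / 2 · V₀`, and
strong convexity of `∑ f_i` turns this into a distance to the optimum.
-/

namespace DEAN

section SymmetricOperators

variable {F : Type*} [NormedAddCommGroup F] [InnerProductSpace ℝ F] {T M S : F →ₗ[ℝ] F} {q c : ℝ}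

theorem norm_apply_sq_le_mul_inner (hT : T.IsSymmetric) (hpos : ∀ x, 0 ≤ inner ℝ x (T x))
    (hc : 0 < c) (hle : ∀ x, inner ℝ x (T x) ≤ c * ‖x‖ ^ 2) (x : F) :
    ‖T x‖ ^ 2 ≤ c * inner ℝ x (T x) := by
  have hsymm : inner ℝ x (T (T x)) = ‖T x‖ ^ 2 := by
    rw [← hT x (T x), real_inner_self_eq_norm_sq]
  have hexp : 0 ≤ inner ℝ x (T x) - 2 * c⁻¹ * ‖T x‖ ^ 2
      + c⁻¹ ^ 2 * inner ℝ (T x) (T (T x)) := by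
    have h := hpos (x - c⁻¹ • T x)
    simp only [map_sub, map_smul, inner_sub_left, inner_sub_right, real_inner_smul_left,
      real_inner_smul_right, hsymm, real_inner_self_eq_norm_sq] at h
    linarith
  have hupper : c⁻¹ ^ 2 * inner ℝ (T x) (T (T x)) ≤ c⁻¹ * ‖T x‖ ^ 2 :=
    calc c⁻¹ ^ 2 * inner ℝ (T x) (T (T x)) ≤ c⁻¹ ^ 2 * (c * ‖T x‖ ^ 2) := by gcongr; exact hle _
      _ = c⁻¹ * ‖T x‖ ^ 2 := by field_simp
  calc ‖T x‖ ^ 2 = c * (c⁻¹ * ‖T x‖ ^ 2) := by field_simp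
    _ ≤ c * inner ℝ x (T x) := by gcongr; linarith

theorem two_mul_inner_apply_le (hS : S.IsSymmetric)
    (hle : ∀ x, |inner ℝ x (S x)| ≤ q * inner ℝ x (T x)) (x y : F) :
    2 * inner ℝ x (S y) ≤ q * (inner ℝ x (T x) + inner ℝ y (T y)) := by
  have hadd := (abs_le.mp (hle (x + y))).2
  have hsub := (abs_le.mp (hle (x - y))).1
  have hsymm : inner ℝ y (S x) = inner ℝ x (S y) := by rw [← hS y x, real_inner_comm]
  simp only [map_add, map_sub, inner_add_left, inner_sub_left, inner_add_right,
    inner_sub_right, hsymm] at hadd hsub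
  linarith

/-- The iteration operator `1 - M T` is self-adjoint for the energy form `⟨x, T y⟩`, so its energy
norm is its numerical radius. -/
theorem inner_sub_comp_le_sq_mul (hT : T.IsSymmetric) (hM : M.IsSymmetric) (hq : 0 ≤ q)
    (hle : ∀ x, |inner ℝ x (T x) - inner ℝ (T x) (M (T x))| ≤ q * inner ℝ x (T x)) (x : F) :
    inner ℝ (x - M (T x)) (T (x - M (T x))) ≤ q ^ 2 * inner ℝ x (T x) := by
  set z := x - M (T x)
  have hpair : ∀ u v, inner ℝ u ((T - T ∘ₗ M ∘ₗ T) v)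
      = inner ℝ u (T v) - inner ℝ (T u) (M (T v)) := fun u v => by
    simp [inner_sub_right, hT u]
  have hS : (T - T ∘ₗ M ∘ₗ T).IsSymmetric := fun u v => by
    simp [inner_sub_left, inner_sub_right, hT _ _, hM _ _]
  have hz : inner ℝ x ((T - T ∘ₗ M ∘ₗ T) z) = inner ℝ z (T z) := by
    rw [hpair, ← hM (T x) (T z), ← inner_sub_left]
  have hpolar := two_mul_inner_apply_le hS (fun u => (hpair u u).symm ▸ hle u) x
  rcases hq.eq_or_lt with rfl | hq
  · linarith [hz ▸ hpolar z]
  · have hopt := hpolar (q⁻¹ • z)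
    simp only [map_smul, real_inner_smul_left, real_inner_smul_right, hz] at hopt
    have hscaled := mul_le_mul_of_nonneg_left hopt hq.le
    field_simp at hscaled
    linarith

end SymmetricOperators

section LaplacianSpectrum

open Matrix

variable {N : ℕ} {A : Matrix (Fin N) (Fin N) ℝ} {hA : A.IsHermitian}
  {b : OrthonormalBasis (Fin N) ℝ (EuclideanSpace ℝ (Fin N))} {v : Fin N → ℝ} {c : ℝ}

theorem eigAsc_monotone (hA : A.IsHermitian) : Monotone (eigAsc hA) := fun i j hij =>
  hA.eigenvalues₀_antitone (by simpa [Fin.le_def] using Fin.rev_le_rev.mpr hij)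

theorem exists_orthonormalBasis_mulVec_eq_eigAsc (hA : A.IsHermitian) :
    ∃ b : OrthonormalBasis (Fin N) ℝ (EuclideanSpace ℝ (Fin N)),
      ∀ k, A *ᵥ (b k).ofLp = eigAsc hA k • (b k).ofLp := by
  let e : Fin N ≃ Fin N := (Fin.revPerm.trans (finCongr (Fintype.card_fin N).symm)).trans
    (Fintype.equivOfCardEq (Fintype.card_fin _))
  refine ⟨hA.eigenvectorBasis.reindex e.symm, fun k => ?_⟩
  rw [OrthonormalBasis.reindex_apply, Equiv.symm_symm, hA.mulVec_eigenvectorBasis]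
  congr 1
  simp [Matrix.IsHermitian.eigenvalues, eigAsc, e]

theorem dotProduct_self_eq_norm_sq (x : EuclideanSpace ℝ (Fin N)) :
    x.ofLp ⬝ᵥ x.ofLp = ‖x‖ ^ 2 := by
  rw [EuclideanSpace.real_norm_sq_eq]
  exact Finset.sum_congr rfl fun i _ => (sq _).symm

theorem dotProduct_mulVec_eq_sum_eigAsc
    (hb : ∀ k, A *ᵥ (b k).ofLp = eigAsc hA k • (b k).ofLp) (v : Fin N → ℝ) :
    v ⬝ᵥ A *ᵥ v = ∑ k, eigAsc hA k * ((b k).ofLp ⬝ᵥ v) ^ 2 := by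
  have hcoeff : ∀ k, (b k).ofLp ⬝ᵥ A *ᵥ v = eigAsc hA k * ((b k).ofLp ⬝ᵥ v) := fun k => by
    rw [dotProduct_mulVec, ← mulVec_transpose, ← conjTranspose_eq_transpose_of_trivial, hA.eq, hb,
      smul_dotProduct, smul_eq_mul]
  have hinner : ∀ x y : Fin N → ℝ, inner ℝ (WithLp.toLp 2 x) (WithLp.toLp 2 y) = x ⬝ᵥ y :=
    fun x y => by rw [EuclideanSpace.inner_toLp_toLp, star_trivial, dotProduct_comm]
  rw [← hinner, ← b.sum_inner_mul_inner]
  refine Finset.sum_congr rfl fun k _ => ?_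
  rw [real_inner_comm, ← WithLp.toLp_ofLp 2 (b k), hinner, hinner, hcoeff]
  ring

theorem dotProduct_self_eq_sum_sq (b : OrthonormalBasis (Fin N) ℝ (EuclideanSpace ℝ (Fin N)))
    (v : Fin N → ℝ) : v ⬝ᵥ v = ∑ k, ((b k).ofLp ⬝ᵥ v) ^ 2 := by
  rw [← WithLp.ofLp_toLp 2 v, dotProduct_self_eq_norm_sq, ← b.sum_sq_inner_right]
  refine Finset.sum_congr rfl fun k _ => ?_
  rw [EuclideanSpace.inner_eq_star_dotProduct, star_trivial, dotProduct_comm]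

theorem dotProduct_mulVec_le_of_eigAsc_le (h : ∀ k, eigAsc hA k ≤ c) (v : Fin N → ℝ) :
    v ⬝ᵥ A *ᵥ v ≤ c * (v ⬝ᵥ v) := by
  obtain ⟨b, hb⟩ := exists_orthonormalBasis_mulVec_eq_eigAsc hA
  rw [dotProduct_mulVec_eq_sum_eigAsc hb, dotProduct_self_eq_sum_sq b, Finset.mul_sum]
  gcongr with k
  exact h k

theorem le_dotProduct_mulVec_of_le_eigAsc
    (hb : ∀ k, A *ᵥ (b k).ofLp = eigAsc hA k • (b k).ofLp)
    (h : ∀ k, (b k).ofLp ⬝ᵥ v ≠ 0 → c ≤ eigAsc hA k) : c * (v ⬝ᵥ v) ≤ v ⬝ᵥ A *ᵥ v := by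
  rw [dotProduct_mulVec_eq_sum_eigAsc hb, dotProduct_self_eq_sum_sq b, Finset.mul_sum]
  refine Finset.sum_le_sum fun k _ => ?_
  by_cases hk : (b k).ofLp ⬝ᵥ v = 0
  · simp [hk]
  · gcongr
    exact h k hk

theorem eigAsc_eq_dotProduct_mulVec
    (hb : ∀ k, A *ᵥ (b k).ofLp = eigAsc hA k • (b k).ofLp) (k : Fin N) :
    eigAsc hA k = (b k).ofLp ⬝ᵥ A *ᵥ (b k).ofLp := by
  rw [hb, dotProduct_smul, dotProduct_self_eq_norm_sq, b.norm_eq_one, one_pow, smul_eq_mul,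
    mul_one]

variable {G : SimpleGraph (Fin N)} [DecidableRel G.Adj]

theorem dotProduct_lapMatrix_mulVec (v : Fin N → ℝ) :
    v ⬝ᵥ G.lapMatrix ℝ *ᵥ v = (∑ i, ∑ j, if G.Adj i j then (v i - v j) ^ 2 else 0) / 2 := by
  rw [← G.lapMatrix_toLinearMap₂' ℝ v, toLinearMap₂'_apply']

theorem exists_eq_const_of_lapMatrix_mulVec_eq_zero (hG : G.Connected)
    (hv : G.lapMatrix ℝ *ᵥ v = 0) : ∃ a, v = fun _ => a := by
  obtain ⟨i⟩ := hG.nonempty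
  exact ⟨v i, funext fun j =>
    G.lapMatrix_mulVec_eq_zero_iff_forall_reachable.mp hv j i (hG.preconnected j i)⟩

theorem dotProduct_lapMatrix_mulVec_le_lamMax (hN : 2 ≤ N) (v : Fin N → ℝ) :
    v ⬝ᵥ G.lapMatrix ℝ *ᵥ v ≤ lamMax hN G * (v ⬝ᵥ v) :=
  dotProduct_mulVec_le_of_eigAsc_le
    (fun _ => eigAsc_monotone (G.isHermitian_lapMatrix ℝ) (Fin.le_def.mpr (by simp; omega))) v

theorem eigAsc_lapMatrix_nonneg (k : Fin N) : 0 ≤ eigAsc (G.isHermitian_lapMatrix (R := ℝ)) k := by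
  obtain ⟨b, hb⟩ := exists_orthonormalBasis_mulVec_eq_eigAsc (G.isHermitian_lapMatrix ℝ)
  rw [eigAsc_eq_dotProduct_mulVec hb]
  simpa using (G.posSemidef_lapMatrix ℝ).dotProduct_mulVec_nonneg (b k).ofLp

theorem eigAsc_lapMatrix_zero (hN : 0 < N) :
    eigAsc (G.isHermitian_lapMatrix (R := ℝ)) ⟨0, hN⟩ = 0 := by
  obtain ⟨b, hb⟩ := exists_orthonormalBasis_mulVec_eq_eigAsc (G.isHermitian_lapMatrix ℝ)
  refine (eigAsc_lapMatrix_nonneg _).antisymm' ?_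
  have hones := le_dotProduct_mulVec_of_le_eigAsc (v := fun _ => 1) hb
    (c := eigAsc _ ⟨0, hN⟩) fun k _ => eigAsc_monotone _ (Fin.le_def.mpr (Nat.zero_le k))
  rw [G.lapMatrix_mulVec_const_eq_zero, dotProduct_zero] at hones
  refine nonpos_of_mul_nonpos_left hones ?_
  simpa [dotProduct] using hN

theorem exists_eigenvector_eq_const (hG : G.Connected)
    (hb : ∀ k, G.lapMatrix ℝ *ᵥ (b k).ofLp = eigAsc (G.isHermitian_lapMatrix ℝ) k • (b k).ofLp)
    {k : Fin N} (hk : eigAsc (G.isHermitian_lapMatrix ℝ) k = 0) :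
    ∃ a ≠ 0, (b k).ofLp = fun _ => a := by
  obtain ⟨a, ha⟩ := exists_eq_const_of_lapMatrix_mulVec_eq_zero hG
    (v := (b k).ofLp) (by rw [hb, hk, zero_smul])
  refine ⟨a, ?_, ha⟩
  rintro rfl
  have hunit := dotProduct_self_eq_norm_sq (b k)
  simp [ha, b.norm_eq_one] at hunit

theorem lam2_mul_le_dotProduct_lapMatrix_mulVec (hN : 2 ≤ N) (hG : G.Connected)
    (hv : ∑ i, v i = 0) : lam2 hN G * (v ⬝ᵥ v) ≤ v ⬝ᵥ G.lapMatrix ℝ *ᵥ v := by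
  obtain ⟨b, hb⟩ := exists_orthonormalBasis_mulVec_eq_eigAsc (G.isHermitian_lapMatrix ℝ)
  refine le_dotProduct_mulVec_of_le_eigAsc hb fun k hk => eigAsc_monotone _ ?_
  refine Fin.le_def.mpr (Nat.one_le_iff_ne_zero.mpr fun hk0 => hk ?_)
  have hk_eq : k = ⟨0, by omega⟩ := Fin.ext hk0
  obtain ⟨a, -, ha⟩ := exists_eigenvector_eq_const hG hb (hk_eq ▸ eigAsc_lapMatrix_zero _)
  simp [ha, dotProduct, ← Finset.mul_sum, hv]

theorem lam2_pos (hN : 2 ≤ N) (hG : G.Connected) : 0 < lam2 hN G := by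
  obtain ⟨b, hb⟩ := exists_orthonormalBasis_mulVec_eq_eigAsc (G.isHermitian_lapMatrix ℝ)
  refine (eigAsc_lapMatrix_nonneg _).lt_of_ne' fun hzero => ?_
  obtain ⟨a₀, ha₀, hb₀⟩ := exists_eigenvector_eq_const hG hb
    (eigAsc_lapMatrix_zero (show 0 < N by omega))
  obtain ⟨a₁, ha₁, hb₁⟩ := exists_eigenvector_eq_const hG hb hzero
  have horth : inner ℝ (b ⟨0, by omega⟩) (b ⟨1, by omega⟩) = (0 : ℝ) := b.orthonormal.2 (by simp)
  simp only [PiLp.inner_apply, hb₀, hb₁, RCLike.inner_apply, conj_trivial, Finset.sum_const,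
    Finset.card_univ, Fintype.card_fin, nsmul_eq_mul, mul_eq_zero, Nat.cast_eq_zero, ha₀, ha₁,
    or_false] at horth
  omega

theorem lam2_le_lamMax (hN : 2 ≤ N) : lam2 hN G ≤ lamMax hN G :=
  eigAsc_monotone _ (Fin.le_def.mpr (by simp; omega))

theorem dotProduct_lapMatrix_mulVec_le_maxDegree (v : Fin N → ℝ) :
    v ⬝ᵥ G.lapMatrix ℝ *ᵥ v ≤ 2 * G.maxDegree * (v ⬝ᵥ v) := by
  have hpair : ∀ i j, (if G.Adj i j then (v i - v j) ^ 2 else 0)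
      ≤ (if G.Adj i j then 2 * v i ^ 2 else 0) + if G.Adj j i then 2 * v j ^ 2 else 0 := by
    intro i j
    by_cases h : G.Adj i j
    · simp only [h, h.symm, if_true]
      linarith [sq_nonneg (v i + v j)]
    · simp [h, G.adj_comm j i]
  have hdegree : ∑ i, ∑ j, (if G.Adj i j then 2 * v i ^ 2 else 0)
      ≤ 2 * G.maxDegree * (v ⬝ᵥ v) := by
    simp only [dotProduct, Finset.mul_sum]
    refine Finset.sum_le_sum fun i _ => ?_
    rw [← Finset.sum_filter, Finset.sum_const, ← G.neighborFinset_eq_filter,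
      G.card_neighborFinset_eq_degree, nsmul_eq_mul]
    have hdeg : (G.degree i : ℝ) ≤ G.maxDegree := mod_cast G.degree_le_maxDegree i
    linarith [mul_le_mul_of_nonneg_right hdeg (by positivity : 0 ≤ 2 * v i ^ 2)]
  have hswap := Finset.sum_comm (s := Finset.univ) (t := Finset.univ)
    (f := fun i j => if G.Adj j i then 2 * v j ^ 2 else 0)
  have hsum := Finset.sum_le_sum fun i (_ : i ∈ Finset.univ) =>
    Finset.sum_le_sum fun j (_ : j ∈ Finset.univ) => hpair i j
  simp only [Finset.sum_add_distrib] at hsum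
  rw [dotProduct_lapMatrix_mulVec]
  linarith

theorem lamMax_le_two_mul_maxDegree (hN : 2 ≤ N) : lamMax hN G ≤ 2 * G.maxDegree := by
  obtain ⟨b, hb⟩ := exists_orthonormalBasis_mulVec_eq_eigAsc (G.isHermitian_lapMatrix ℝ)
  have htop := dotProduct_lapMatrix_mulVec_le_maxDegree (G := G) (b ⟨N - 1, by omega⟩).ofLp
  rwa [← eigAsc_eq_dotProduct_mulVec hb, dotProduct_self_eq_norm_sq, b.norm_eq_one, one_pow,
    mul_one] at htop

theorem dotProduct_lapMatrix_mulVec_of_lam2_eq_lamMax (hN : 2 ≤ N) (hG : G.Connected)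
    (h : lam2 hN G = lamMax hN G) (v : Fin N → ℝ) :
    v ⬝ᵥ G.lapMatrix ℝ *ᵥ v = lamMax hN G * (v ⬝ᵥ v - (∑ i, v i) ^ 2 / N) := by
  have hN0 : (N : ℝ) ≠ 0 := by positivity
  set w : Fin N → ℝ := fun i => v i - (∑ j, v j) / N
  have hw : ∑ i, w i = 0 := by simp [w, Finset.sum_sub_distrib, hN0, mul_div_cancel₀]
  have hform : w ⬝ᵥ G.lapMatrix ℝ *ᵥ w = v ⬝ᵥ G.lapMatrix ℝ *ᵥ v := by
    simp [dotProduct_lapMatrix_mulVec, w]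
  have hnorm : w ⬝ᵥ w = v ⬝ᵥ v - (∑ i, v i) ^ 2 / N := by
    have hexp : ∀ i, w i * w i
        = v i * v i - 2 * ((∑ j, v j) / N) * v i + ((∑ j, v j) / N) ^ 2 := fun i => by ring
    simp only [dotProduct, hexp, Finset.sum_add_distrib, Finset.sum_sub_distrib, ← Finset.mul_sum,
      Finset.sum_const, Finset.card_univ, Fintype.card_fin, nsmul_eq_mul]
    field_simp
    ring
  rw [← hform, ← hnorm]
  exact (dotProduct_lapMatrix_mulVec_le_lamMax hN w).antisymm
    (h ▸ lam2_mul_le_dotProduct_lapMatrix_mulVec hN hG hw)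

theorem lapMatrix_apply_of_lam2_eq_lamMax (hN : 2 ≤ N) (hG : G.Connected)
    (h : lam2 hN G = lamMax hN G) {i j : Fin N} (hij : i ≠ j) :
    G.lapMatrix ℝ i j = -(lamMax hN G / N) := by
  have hform := dotProduct_lapMatrix_mulVec_of_lam2_eq_lamMax hN hG h
  have hi := hform (Pi.single i 1)
  have hj := hform (Pi.single j 1)
  have hadd := hform (Pi.single i 1 + Pi.single j 1)
  simp only [mulVec_add, add_dotProduct, dotProduct_add, Pi.add_apply, Finset.sum_add_distrib]
    at hadd
  simp only [mulVec_single, MulOpposite.op_one, one_smul, single_dotProduct, col_apply, one_mul,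
    dotProduct_single, Pi.single_eq_same, mul_one, Finset.sum_pi_single', Finset.mem_univ,
    ↓reduceIte, one_pow, (G.isSymm_lapMatrix (R := ℝ)).apply i j, Pi.single_eq_of_ne,
    ne_eq, hij, hij.symm, not_false_eq_true, add_zero, zero_add] at hi hj hadd
  linear_combination (hadd - hi - hj) / 2

theorem eq_top_of_lam2_eq_lamMax (hN : 2 ≤ N) (hG : G.Connected) (h : lam2 hN G = lamMax hN G) :
    G = ⊤ ∧ lamMax hN G = N := by
  have hpos : 0 < lamMax hN G := h ▸ lam2_pos hN hG
  have hN0 : (0 : ℝ) < N := by positivity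
  have hentry : ∀ {i j : Fin N}, i ≠ j → (if G.Adj i j then (1 : ℝ) else 0) = lamMax hN G / N :=
    fun hij => by
      rw [← neg_inj, ← lapMatrix_apply_of_lam2_eq_lamMax hN hG h hij]
      simp [SimpleGraph.lapMatrix, SimpleGraph.degMatrix, hij, SimpleGraph.adjMatrix_apply]
  have hadj : ∀ {i j : Fin N}, i ≠ j → G.Adj i j := fun hij => by
    by_contra hnot
    exact (div_pos hpos hN0).ne ((if_neg hnot).symm.trans (hentry hij))
  have h01 : (⟨0, by omega⟩ : Fin N) ≠ ⟨1, by omega⟩ := by simp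
  refine ⟨by ext i j; simpa using ⟨fun hij => hij.ne, hadj⟩, ?_⟩
  have hratio := hentry h01
  rw [if_pos (hadj h01), eq_div_iff hN0.ne'] at hratio
  linarith

end LaplacianSpectrum

section Coercive

variable {F : Type*} [NormedAddCommGroup F] [InnerProductSpace ℝ F] {H : F →L[ℝ] F} {c C : ℝ}

theorem mul_norm_le_norm_of_le_inner {v w : F} (h : c * ‖v‖ ^ 2 ≤ inner ℝ v w) :
    c * ‖v‖ ≤ ‖w‖ := by
  rcases (norm_nonneg v).eq_or_lt with hv | hv
  · rw [← hv, mul_zero]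
    positivity
  · have hinner := h.trans (real_inner_le_norm v w)
    exact le_of_mul_le_mul_left (by linarith [sq ‖v‖]) hv

theorem mul_inner_le_norm_sq (hc : 0 ≤ c) {v w : F} (h : c * ‖v‖ ^ 2 ≤ inner ℝ v w) :
    c * inner ℝ v w ≤ ‖w‖ ^ 2 :=
  calc c * inner ℝ v w ≤ c * (‖v‖ * ‖w‖) := by gcongr; exact real_inner_le_norm v w
    _ = c * ‖v‖ * ‖w‖ := by ring
    _ ≤ ‖w‖ * ‖w‖ := by gcongr; exact mul_norm_le_norm_of_le_inner h
    _ = ‖w‖ ^ 2 := (sq ‖w‖).symm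

variable [FiniteDimensional ℝ F]

theorem isInvertible_of_coercive (hc0 : 0 < c) (hc : ∀ v, c * ‖v‖ ^ 2 ≤ inner ℝ v (H v)) :
    H.IsInvertible := by
  have hinj : Function.Injective (H : F →ₗ[ℝ] F) := by
    refine (injective_iff_map_eq_zero _).mpr fun v hv => norm_le_zero_iff.mp ?_
    have hnorm := mul_norm_le_norm_of_le_inner (hc v)
    rw [show H v = 0 from hv, norm_zero] at hnorm
    exact nonpos_of_mul_nonpos_right hnorm hc0
  exact ⟨(LinearEquiv.ofInjectiveEndo _ hinj).toContinuousLinearEquiv, by ext; rfl⟩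

theorem norm_inverse_apply_le (hc0 : 0 < c) (hc : ∀ v, c * ‖v‖ ^ 2 ≤ inner ℝ v (H v)) (v : F) :
    ‖H.inverse v‖ ≤ ‖v‖ / c := by
  have hnorm := mul_norm_le_norm_of_le_inner (hc (H.inverse v))
  rw [(isInvertible_of_coercive hc0 hc).self_apply_inverse] at hnorm
  rwa [le_div_iff₀' hc0]

theorem inner_inverse_apply_le (hc0 : 0 < c) (hc : ∀ v, c * ‖v‖ ^ 2 ≤ inner ℝ v (H v)) (v : F) :
    inner ℝ v (H.inverse v) ≤ ‖v‖ ^ 2 / c :=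
  calc inner ℝ v (H.inverse v) ≤ ‖v‖ * ‖H.inverse v‖ := real_inner_le_norm _ _
    _ ≤ ‖v‖ * (‖v‖ / c) := by gcongr; exact norm_inverse_apply_le hc0 hc v
    _ = ‖v‖ ^ 2 / c := by ring

theorem le_inner_inverse_apply (hH : (H : F →ₗ[ℝ] F).IsSymmetric) (hc0 : 0 < c)
    (hc : ∀ v, c * ‖v‖ ^ 2 ≤ inner ℝ v (H v)) (hC0 : 0 < C)
    (hC : ∀ v, inner ℝ v (H v) ≤ C * ‖v‖ ^ 2) (v : F) :
    ‖v‖ ^ 2 / C ≤ inner ℝ v (H.inverse v) := by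
  have hpos : ∀ x, 0 ≤ inner ℝ x (H x) := fun x => (by positivity : 0 ≤ c * ‖x‖ ^ 2).trans (hc x)
  have hnorm := norm_apply_sq_le_mul_inner hH hpos hC0 hC (H.inverse v)
  rw [ContinuousLinearMap.coe_coe, (isInvertible_of_coercive hc0 hc).self_apply_inverse,
    real_inner_comm] at hnorm
  rwa [div_le_iff₀' hC0]

theorem isSymmetric_inverse (hH : (H : F →ₗ[ℝ] F).IsSymmetric) (hc0 : 0 < c)
    (hc : ∀ v, c * ‖v‖ ^ 2 ≤ inner ℝ v (H v)) : (H.inverse : F →ₗ[ℝ] F).IsSymmetric := by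
  intro v w
  have hsymm := hH (H.inverse v) (H.inverse w)
  simp only [ContinuousLinearMap.coe_coe,
    (isInvertible_of_coercive hc0 hc).self_apply_inverse] at hsymm ⊢
  exact hsymm.symm

end Coercive

section Calculus

variable {n : ℕ} {f : E n → ℝ} {S : Set (E n)} {c C L : ℝ} {x y : E n}

theorem contDiff_gradient (hf : ContDiff ℝ 2 f) : ContDiff ℝ 1 (gradient f) :=
  (InnerProductSpace.toDual ℝ (E n)).symm.contDiff.comp (hf.fderiv_right (by norm_num))

theorem hasFDerivAt_gradient (hf : ContDiff ℝ 2 f) (x : E n) :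
    HasFDerivAt (gradient f) (hess f x) x :=
  ((contDiff_gradient hf).differentiable (by norm_num) x).hasFDerivAt

theorem continuous_bregman (hf : ContDiff ℝ 2 f) (y : E n) : Continuous (bregman f y) := by
  have hcont := hf.continuous
  have hgrad := (contDiff_gradient hf).continuous
  unfold bregman
  fun_prop

theorem isSymmetric_hess (hf : ContDiff ℝ 2 f) (x : E n) :
    (hess f x : E n →ₗ[ℝ] E n).IsSymmetric := by
  have hfderiv : HasFDerivAt (fderiv ℝ f) (fderiv ℝ (fderiv ℝ f) x) x :=
    ((hf.fderiv_right (m := 1) (by norm_num)).differentiable (by norm_num) x).hasFDerivAt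
  have hpair : ∀ v w, inner ℝ (hess f x v) w = fderiv ℝ (fderiv ℝ f) x v w := by
    intro v w
    have hgrad := (hasFDerivAt_gradient hf x).inner ℝ (hasFDerivAt_const w x)
    have heval := hfderiv.clm_apply (hasFDerivAt_const w x)
    simp only [inner_gradient_left] at hgrad
    simpa using congrArg (fun T => T v) (hgrad.unique heval)
  intro v w
  rw [ContinuousLinearMap.coe_coe, hpair, real_inner_comm, hpair]
  exact (hf.contDiffAt.isSymmSndFDerivAt (by simp)).eq v w

theorem hasDerivAt_add_smul (x d : E n) (t : ℝ) : HasDerivAt (fun t : ℝ => x + t • d) d t := by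
  simpa using ((hasDerivAt_id t).smul_const d).const_add x

theorem hasDerivAt_comp_add_smul (hf : Differentiable ℝ f) (x d : E n) (t : ℝ) :
    HasDerivAt (fun t : ℝ => f (x + t • d)) (inner ℝ (gradient f (x + t • d)) d) t := by
  rw [inner_gradient_left]
  exact (hf (x + t • d)).hasFDerivAt.comp_hasDerivAt t (hasDerivAt_add_smul x d t)

theorem hasDerivAt_gradient_comp_add_smul (hf : ContDiff ℝ 2 f) (x d : E n) (t : ℝ) :
    HasDerivAt (fun t : ℝ => gradient f (x + t • d)) (hess f (x + t • d) d) t :=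
  HasFDerivAt.comp_hasDerivAt (f := fun t : ℝ => x + t • d) t (hasFDerivAt_gradient hf _)
    (hasDerivAt_add_smul x d t)

theorem hasDerivAt_inner_gradient_comp_add_smul (hf : ContDiff ℝ 2 f) (x d : E n) (t : ℝ) :
    HasDerivAt (fun t : ℝ => inner ℝ (gradient f (x + t • d)) d)
      (inner ℝ d (hess f (x + t • d) d)) t := by
  simpa [real_inner_comm] using
    (hasDerivAt_gradient_comp_add_smul hf x d t).inner ℝ (hasDerivAt_const t d)

theorem add_smul_sub_mem_segment {t : ℝ} (h0 : 0 ≤ t) (h1 : t ≤ 1) :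
    x + t • (y - x) ∈ segment ℝ x y := by
  rw [segment_eq_image']
  exact ⟨t, ⟨h0, h1⟩, rfl⟩

theorem exists_inner_gradient_sub_eq (hf : ContDiff ℝ 2 f) (x y : E n) :
    ∃ z ∈ segment ℝ x y,
      inner ℝ (gradient f y - gradient f x) (y - x) = inner ℝ (y - x) (hess f z (y - x)) := by
  have hderiv := hasDerivAt_inner_gradient_comp_add_smul hf x (y - x)
  obtain ⟨t, ht, hslope⟩ := exists_hasDerivAt_eq_slope _ _ (zero_lt_one' ℝ)
    (fun t _ => (hderiv t).continuousAt.continuousWithinAt) (fun t _ => hderiv t)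
  refine ⟨_, add_smul_sub_mem_segment ht.1.le ht.2.le, ?_⟩
  rw [hslope, zero_smul, add_zero, one_smul, add_sub_cancel, sub_zero, div_one, inner_sub_left]

theorem exists_bregman_eq (hf : ContDiff ℝ 2 f) (x y : E n) :
    ∃ z ∈ segment ℝ x y, bregman f y x = 1 / 2 * inner ℝ (y - x) (hess f z (y - x)) := by
  set g : ℝ → ℝ := fun t => f (x + t • (y - x))
  have hg : ContDiff ℝ 2 g := by fun_prop
  have hderiv : deriv g = fun t => inner ℝ (gradient f (x + t • (y - x))) (y - x) :=
    funext fun t => (hasDerivAt_comp_add_smul (hf.differentiable (by norm_num)) x _ t).deriv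
  have hderiv2 : ∀ t, iteratedDeriv 2 g t
      = inner ℝ (y - x) (hess f (x + t • (y - x)) (y - x)) := fun t => by
    rw [iteratedDeriv_succ, iteratedDeriv_one, hderiv]
    exact (hasDerivAt_inner_gradient_comp_add_smul hf x _ t).deriv
  obtain ⟨t, ht, htaylor⟩ := taylor_mean_remainder_lagrange_iteratedDeriv (n := 1)
    (zero_ne_one' ℝ) (hg.contDiffOn)
  rw [Set.uIoo_of_le zero_le_one] at ht
  have hderiv0 : derivWithin g (Set.uIcc 0 1) 0 = inner ℝ (gradient f x) (y - x) := by
    rw [(hg.differentiable (by norm_num) 0).derivWithin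
      (uniqueDiffOn_uIcc (zero_ne_one' ℝ) 0 Set.left_mem_uIcc), hderiv]
    simp only [zero_smul, add_zero]
  have hpoly : taylorWithinEval g 1 (Set.uIcc 0 1) 0 1
      = f x + inner ℝ (gradient f x) (y - x) := by
    rw [taylorWithinEval_succ, taylor_within_zero_eval, iteratedDerivWithin_one, hderiv0]
    simp only [g, zero_smul, add_zero]
    norm_num
  rw [hpoly, hderiv2] at htaylor
  refine ⟨_, add_smul_sub_mem_segment ht.1.le ht.2.le, ?_⟩
  calc bregman f y x = g 1 - (f x + inner ℝ (gradient f x) (y - x)) := by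
        simp only [bregman, g, one_smul, add_sub_cancel, sub_add_eq_sub_sub]
    _ = 1 / 2 * inner ℝ (y - x) (hess f (x + t • (y - x)) (y - x)) := by
        rw [htaylor]
        norm_num
        ring

theorem HessLowerBound.le_of_hessUpperBound (hc : HessLowerBound f S c) (hC : HessUpperBound f S C)
    (hn : 1 ≤ n) (hx : x ∈ S) : c ≤ C := by
  have hv := (hc x hx (EuclideanSpace.single ⟨0, hn⟩ 1)).trans (hC x hx _)
  simpa using hv

theorem HessLowerBound.le_bregman (h : HessLowerBound f S c) (hf : ContDiff ℝ 2 f)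
    (hS : Convex ℝ S) (hx : x ∈ S) (hy : y ∈ S) : c / 2 * ‖y - x‖ ^ 2 ≤ bregman f y x := by
  obtain ⟨z, hz, htaylor⟩ := exists_bregman_eq hf x y
  linarith [h z (hS.segment_subset hx hy hz) (y - x)]

theorem HessUpperBound.bregman_le (h : HessUpperBound f S C) (hf : ContDiff ℝ 2 f)
    (hS : Convex ℝ S) (hx : x ∈ S) (hy : y ∈ S) : bregman f y x ≤ C / 2 * ‖y - x‖ ^ 2 := by
  obtain ⟨z, hz, htaylor⟩ := exists_bregman_eq hf x y
  linarith [h z (hS.segment_subset hx hy hz) (y - x)]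

theorem HessLowerBound.le_inner_gradient_sub (h : HessLowerBound f S c) (hf : ContDiff ℝ 2 f)
    (hS : Convex ℝ S) (hx : x ∈ S) (hy : y ∈ S) :
    c * ‖y - x‖ ^ 2 ≤ inner ℝ (gradient f y - gradient f x) (y - x) := by
  obtain ⟨z, hz, hmean⟩ := exists_inner_gradient_sub_eq hf x y
  exact (h z (hS.segment_subset hx hy hz) (y - x)).trans_eq hmean.symm

theorem HessLipschitz.norm_hess_sub_apply_le (h : HessLipschitz f S L) (hS : Convex ℝ S)
    (hx : x ∈ S) (hy : y ∈ S) {t : ℝ} (h0 : 0 ≤ t) (h1 : t ≤ 1) :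
    ‖hess f (x + t • (y - x)) (y - x) - hess f x (y - x)‖ ≤ L * ‖y - x‖ ^ 2 * t := by
  have hmem := hS.segment_subset hx hy (add_smul_sub_mem_segment h0 h1)
  calc ‖hess f (x + t • (y - x)) (y - x) - hess f x (y - x)‖
      = ‖(hess f (x + t • (y - x)) - hess f x) (y - x)‖ := by simp
    _ ≤ ‖hess f (x + t • (y - x)) - hess f x‖ * ‖y - x‖ := ContinuousLinearMap.le_opNorm _ _
    _ ≤ L * ‖x + t • (y - x) - x‖ * ‖y - x‖ := by gcongr; exact h _ hmem _ hx
    _ = L * ‖y - x‖ ^ 2 * t := by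
      rw [add_sub_cancel_left, norm_smul, Real.norm_of_nonneg h0]
      ring

theorem HessLipschitz.norm_gradient_remainder_le (h : HessLipschitz f S L) (hf : ContDiff ℝ 2 f)
    (hS : Convex ℝ S) (hx : x ∈ S) (hy : y ∈ S) :
    ‖gradient f y - gradient f x - hess f x (y - x)‖ ≤ L / 2 * ‖y - x‖ ^ 2 := by
  have hremainder : ∀ t : ℝ, HasDerivAt
      (fun t : ℝ => gradient f (x + t • (y - x)) - gradient f x - t • hess f x (y - x))
      (hess f (x + t • (y - x)) (y - x) - hess f x (y - x)) t := fun t =>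
    (((hasDerivAt_gradient_comp_add_smul hf x _ t).sub_const (gradient f x)).sub
      ((hasDerivAt_id t).smul_const (hess f x (y - x)))).congr_deriv (by simp)
  have hbound : ∀ t : ℝ, HasDerivAt (fun t : ℝ => L / 2 * ‖y - x‖ ^ 2 * t ^ 2)
      (L * ‖y - x‖ ^ 2 * t) t := fun t =>
    ((hasDerivAt_pow 2 t).const_mul (L / 2 * ‖y - x‖ ^ 2)).congr_deriv (by push_cast; ring)
  simpa using image_norm_le_of_norm_deriv_right_le_deriv_boundary (a := 0) (b := 1)
    (fun t _ => (hremainder t).continuousAt.continuousWithinAt)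
    (fun t _ => (hremainder t).hasDerivWithinAt) (by simp) hbound
    (fun t ht => h.norm_hess_sub_apply_le hS hx hy ht.1 ht.2.le)
    (Set.right_mem_Icc.mpr zero_le_one)

theorem bregman_nonneg (hconv : ConvexOn ℝ Set.univ f) (hf : Differentiable ℝ f) (x y : E n) :
    0 ≤ bregman f y x := by
  have hline : ConvexOn ℝ Set.univ fun t : ℝ => f (x + t • (y - x)) := by
    have h := hconv.comp_affineMap (AffineMap.lineMap x y)
    rw [Set.preimage_univ] at h
    refine h.congr fun t _ => ?_
    simp [AffineMap.lineMap_apply, add_comm]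
  have hslope := hline.le_slope_of_hasDerivAt (Set.mem_univ 0) (Set.mem_univ 1) one_pos
    (hasDerivAt_comp_add_smul hf x (y - x) 0)
  simp only [slope_def_field, zero_smul, one_smul, add_zero, add_sub_cancel, sub_zero,
    div_one] at hslope
  rw [bregman]
  linarith

theorem convexOn_of_bregman_nonneg (h : ∀ x y, 0 ≤ bregman f y x) : ConvexOn ℝ Set.univ f := by
  refine ⟨convex_univ, fun x _ y _ a b ha hb hab => ?_⟩
  set z := a • x + b • y
  have hcancel : a * inner ℝ (gradient f z) (x - z) + b * inner ℝ (gradient f z) (y - z) = 0 := by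
    rw [← real_inner_smul_right, ← real_inner_smul_right, ← inner_add_right, smul_sub, smul_sub,
      sub_add_sub_comm, ← add_smul, hab, one_smul, sub_self, inner_zero_right]
  have hx := mul_nonneg ha (h z x)
  have hy := mul_nonneg hb (h z y)
  simp only [bregman, smul_eq_mul] at hx hy ⊢
  linear_combination hx + hy - hcancel - f z * hab

theorem LocallyStronglyConvex.convexOn (h : LocallyStronglyConvex f) (hf : ContDiff ℝ 2 f) :
    ConvexOn ℝ Set.univ f := by
  refine convexOn_of_bregman_nonneg fun x y => ?_
  obtain ⟨c, hc, hlower⟩ := h (segment ℝ x y) (convex_segment x y) (by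
    rw [segment_eq_image']
    exact isCompact_Icc.image (by fun_prop))
  exact (by positivity : (0 : ℝ) ≤ c / 2 * ‖y - x‖ ^ 2).trans
    (hlower.le_bregman hf (convex_segment x y) (left_mem_segment ℝ x y)
      (right_mem_segment ℝ x y))

theorem gradient_eq_zero_of_isMinOn (h : IsMinOn f Set.univ x) : gradient f x = 0 := by
  rw [gradient, (h.isLocalMin Filter.univ_mem).fderiv_eq_zero, map_zero]

end Calculus

theorem inner_stack {N n : ℕ} (x y : Stack N n) : inner ℝ x y = ∑ i, inner ℝ (x i) (y i) :=
  PiLp.inner_apply x y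

section WeightedLaplacian

open Matrix

variable {N n : ℕ} {G : SimpleGraph (Fin N)} [DecidableRel G.Adj] {α β : Sym2 (Fin N) → ℝ}
  {a : ℝ}

/-- The Laplacian of `G` with edge weights `α`, acting blockwise on stacked vectors: the matrix
`L_α ⊗ I_n`. One DEAN update preconditions it by the inverse Hessians. -/
noncomputable def wlap (G : SimpleGraph (Fin N)) [DecidableRel G.Adj] (α : Sym2 (Fin N) → ℝ) :
    Stack N n →ₗ[ℝ] Stack N n where
  toFun x := WithLp.toLp 2 fun i => ∑ j ∈ G.neighborFinset i, α s(i, j) • (x i - x j)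
  map_add' x y := by
    ext1 i
    simp only [PiLp.add_apply, ← Finset.sum_add_distrib, ← smul_add, add_sub_add_comm]
  map_smul' c x := by
    ext1 i
    simp only [PiLp.smul_apply, Finset.smul_sum, RingHom.id_apply, ← smul_sub, smul_comm c]

theorem wlap_apply (x : Stack N n) (i : Fin N) :
    wlap G α x i = ∑ j ∈ G.neighborFinset i, α s(i, j) • (x i - x j) := rfl

theorem norm_wlap_apply_le (hα : ∀ e ∈ G.edgeSet, 0 ≤ α e) (x : Stack N n) (i : Fin N) :
    ‖wlap G α x i‖ ≤ ∑ j ∈ G.neighborFinset i, α s(i, j) * ‖x i - x j‖ := by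
  rw [wlap_apply]
  refine norm_sum_le_of_le _ fun j hj => ?_
  rw [norm_smul, Real.norm_of_nonneg (hα _ (by simpa using hj))]

theorem sum_neighborFinset_comm (F : Fin N → Fin N → ℝ) :
    ∑ i, ∑ j ∈ G.neighborFinset i, F i j = ∑ i, ∑ j ∈ G.neighborFinset i, F j i :=
  Finset.sum_comm' (by simp [G.adj_comm])

theorem inner_wlap (x y : Stack N n) :
    inner ℝ y (wlap G α x) =
      1 / 2 * ∑ i, ∑ j ∈ G.neighborFinset i, α s(i, j) * inner ℝ (y i - y j) (x i - x j) := by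
  have hfst : inner ℝ y (wlap G α x) =
      ∑ i, ∑ j ∈ G.neighborFinset i, α s(i, j) * inner ℝ (y i) (x i - x j) := by
    simp only [inner_stack, wlap_apply, inner_sum, real_inner_smul_right]
  have hsnd : inner ℝ y (wlap G α x) =
      -∑ i, ∑ j ∈ G.neighborFinset i, α s(i, j) * inner ℝ (y j) (x i - x j) := by
    rw [hfst, sum_neighborFinset_comm]
    simp only [← Finset.sum_neg_distrib, ← mul_neg, ← inner_neg_right, neg_sub]
    simp only [Sym2.eq_swap]
  simp only [inner_sub_left, mul_sub, Finset.sum_sub_distrib] at hfst hsnd ⊢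
  linarith

theorem inner_wlap_self (x : Stack N n) :
    inner ℝ x (wlap G α x) =
      1 / 2 * ∑ i, ∑ j ∈ G.neighborFinset i, α s(i, j) * ‖x i - x j‖ ^ 2 := by
  simp only [inner_wlap, real_inner_self_eq_norm_sq]

theorem isSymmetric_wlap : (wlap G α : Stack N n →ₗ[ℝ] Stack N n).IsSymmetric := by
  intro x y
  rw [real_inner_comm, inner_wlap, inner_wlap]
  simp only [real_inner_comm]

theorem wlap_consensus (z : E n) : wlap G α (consensus N z) = 0 := by
  ext1 i
  simp [wlap_apply, consensus]

theorem inner_consensus_wlap (z : E n) (x : Stack N n) :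
    inner ℝ (consensus N z) (wlap G α x) = 0 := by
  rw [← isSymmetric_wlap, wlap_consensus, inner_zero_left]

theorem sum_wlap_apply (x : Stack N n) : ∑ i, wlap G α x i = 0 := by
  refine ext_inner_left ℝ fun v => ?_
  simpa only [inner_zero_right, inner_sum, inner_stack, consensus] using
    inner_consensus_wlap (G := G) (α := α) v x

theorem inner_wlap_self_mono (h : ∀ e ∈ G.edgeSet, α e ≤ β e) (x : Stack N n) :
    inner ℝ x (wlap G α x) ≤ inner ℝ x (wlap G β x) := by
  rw [inner_wlap_self, inner_wlap_self]
  gcongr with i _ j hj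
  exact h _ (by simpa using hj)

theorem inner_wlap_self_nonneg (h : ∀ e ∈ G.edgeSet, 0 ≤ α e) (x : Stack N n) :
    0 ≤ inner ℝ x (wlap G α x) := by
  simpa [inner_wlap_self] using inner_wlap_self_mono (α := 0) h x

theorem inner_wlap_const_self (a : ℝ) (x : Stack N n) :
    inner ℝ x (wlap G (fun _ => a) x) =
      a * ∑ c, (fun i => x i c) ⬝ᵥ G.lapMatrix ℝ *ᵥ fun i => x i c := by
  have hpair : ∀ i j, ∑ c, (if G.Adj i j then (x i c - x j c) ^ 2 else 0)
      = if G.Adj i j then ‖x i - x j‖ ^ 2 else 0 := fun i j => by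
    split_ifs <;> simp [EuclideanSpace.real_norm_sq_eq]
  have hcoord : ∑ c, (fun i => x i c) ⬝ᵥ G.lapMatrix ℝ *ᵥ (fun i => x i c)
      = 1 / 2 * ∑ i, ∑ j ∈ G.neighborFinset i, ‖x i - x j‖ ^ 2 := by
    simp only [dotProduct_lapMatrix_mulVec, G.neighborFinset_eq_filter, Finset.sum_filter, ← hpair]
    rw [← Finset.sum_div, Finset.sum_comm, div_eq_inv_mul, one_div]
    congr 1
    exact Finset.sum_congr rfl fun i _ => Finset.sum_comm
  rw [hcoord, inner_wlap_self]
  simp only [← Finset.mul_sum]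
  ring

theorem norm_sq_eq_sum_dotProduct (x : Stack N n) :
    ‖x‖ ^ 2 = ∑ c, (fun i => x i c) ⬝ᵥ (fun i => x i c) := by
  simp only [PiLp.norm_sq_eq_of_L2, dotProduct, Real.norm_eq_abs, sq_abs]
  rw [Finset.sum_comm]
  simp only [sq]

theorem inner_wlap_self_le (hN : 2 ≤ N) (ha : 0 ≤ a) (h : ∀ e ∈ G.edgeSet, α e ≤ a)
    (x : Stack N n) : inner ℝ x (wlap G α x) ≤ a * lamMax hN G * ‖x‖ ^ 2 := by
  refine (inner_wlap_self_mono h x).trans ?_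
  rw [inner_wlap_const_self, mul_assoc, norm_sq_eq_sum_dotProduct, Finset.mul_sum (a := lamMax _ _)]
  gcongr
  exact dotProduct_lapMatrix_mulVec_le_lamMax hN _

theorem norm_wlap_sq_le (hN : 2 ≤ N) (hG : G.Connected) (ha : 0 < a)
    (hα : ∀ e ∈ G.edgeSet, 0 ≤ α e) (h : ∀ e ∈ G.edgeSet, α e ≤ a) (x : Stack N n) :
    ‖wlap G α x‖ ^ 2 ≤ a * lamMax hN G * inner ℝ x (wlap G α x) :=
  norm_apply_sq_le_mul_inner isSymmetric_wlap (inner_wlap_self_nonneg hα)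
    (mul_pos ha ((lam2_pos hN hG).trans_le (lam2_le_lamMax hN))) (inner_wlap_self_le hN ha.le h) x

theorem le_inner_wlap_self_of_sum_eq_zero (hN : 2 ≤ N) (hG : G.Connected) (ha : 0 ≤ a)
    (h : ∀ e ∈ G.edgeSet, a ≤ α e) {x : Stack N n} (hx : ∑ i, x i = 0) :
    a * lam2 hN G * ‖x‖ ^ 2 ≤ inner ℝ x (wlap G α x) := by
  refine le_trans ?_ (inner_wlap_self_mono h x)
  rw [inner_wlap_const_self, mul_assoc, norm_sq_eq_sum_dotProduct, Finset.mul_sum (a := lam2 _ _)]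
  gcongr with c
  exact lam2_mul_le_dotProduct_lapMatrix_mulVec hN hG
    (by simpa using congrArg (fun v : E n => v c) hx)

/-- The average `(x_1 + ⋯ + x_N) / N` of the blocks of a stacked vector; the associated consensus
vector is the orthogonal projection onto the kernel of the weighted Laplacian. -/
noncomputable def average (x : Stack N n) : E n := (N : ℝ)⁻¹ • ∑ i, x i

theorem sum_sub_consensus_average (hN : N ≠ 0) (x : Stack N n) :
    ∑ i, (x - consensus N (average x)) i = 0 := by
  have hN0 : (N : ℝ) ≠ 0 := Nat.cast_ne_zero.mpr hN
  simp [consensus, average, ← Nat.cast_smul_eq_nsmul ℝ, smul_smul, hN0]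

theorem le_inner_wlap_self (hN : 2 ≤ N) (hG : G.Connected) (ha : 0 ≤ a)
    (h : ∀ e ∈ G.edgeSet, a ≤ α e) (x : Stack N n) :
    a * lam2 hN G * ‖x - consensus N (average x)‖ ^ 2 ≤
      inner ℝ (x - consensus N (average x)) (wlap G α x) := by
  simpa only [map_sub, wlap_consensus, sub_zero] using
    le_inner_wlap_self_of_sum_eq_zero hN hG ha h (sum_sub_consensus_average (by omega) x)

theorem mul_inner_wlap_self_le_norm_sq (hN : 2 ≤ N) (hG : G.Connected) (ha : 0 ≤ a)
    (h : ∀ e ∈ G.edgeSet, a ≤ α e) (x : Stack N n) :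
    a * lam2 hN G * inner ℝ x (wlap G α x) ≤ ‖wlap G α x‖ ^ 2 := by
  simpa only [inner_sub_left, inner_consensus_wlap, sub_zero] using
    mul_inner_le_norm_sq (mul_nonneg ha (lam2_pos hN hG).le) (le_inner_wlap_self hN hG ha h x)

theorem eq_consensus_of_inner_wlap_self_eq_zero (hN : 2 ≤ N) (hG : G.Connected) (ha : 0 < a)
    (h : ∀ e ∈ G.edgeSet, a ≤ α e) {x : Stack N n} (hx : inner ℝ x (wlap G α x) = 0) :
    x = consensus N (average x) := by
  have hle := le_inner_wlap_self hN hG ha.le h x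
  rw [inner_sub_left, inner_consensus_wlap, hx, sub_zero] at hle
  have hsq := nonpos_of_mul_nonpos_right hle (mul_pos ha (lam2_pos hN hG))
  exact sub_eq_zero.mp (norm_eq_zero.mp (pow_eq_zero_iff two_ne_zero |>.mp
    (hsq.antisymm (sq_nonneg _))))

/-- Multiplication by `1 - M L_α` damps every eigenmode by at most `q`: the preconditioner lies
between `1 / C` and `1 / c`, and the nonzero spectrum of `L_α` between `b λ₂` and `a λ_max`. -/
theorem abs_inner_wlap_sub_inner_le {M : Stack N n →ₗ[ℝ] Stack N n} {b c C q : ℝ} (hN : 2 ≤ N)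
    (hG : G.Connected) (hb : 0 < b) (hαb : ∀ e ∈ G.edgeSet, b ≤ α e) (ha : 0 < a)
    (hαa : ∀ e ∈ G.edgeSet, α e ≤ a) (hc : 0 < c) (hMc : ∀ v, inner ℝ v (M v) ≤ ‖v‖ ^ 2 / c)
    (hC : 0 < C) (hMC : ∀ v, ‖v‖ ^ 2 / C ≤ inner ℝ v (M v)) (hqa : a * lamMax hN G / c - 1 ≤ q)
    (hqb : 1 - b * lam2 hN G / C ≤ q) (x : Stack N n) :
    |inner ℝ x (wlap G α x) - inner ℝ (wlap G α x) (M (wlap G α x))| ≤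
      q * inner ℝ x (wlap G α x) := by
  have hα : ∀ e ∈ G.edgeSet, 0 ≤ α e := fun e he => hb.le.trans (hαb e he)
  have hnonneg := inner_wlap_self_nonneg hα x
  have hupper := norm_wlap_sq_le hN hG ha hα hαa x
  have hlower := mul_inner_wlap_self_le_norm_sq hN hG hb.le hαb x
  set Q := inner ℝ x (wlap G α x)
  have hMupper : inner ℝ (wlap G α x) (M (wlap G α x)) ≤ (1 + q) * Q :=
    calc inner ℝ (wlap G α x) (M (wlap G α x)) ≤ ‖wlap G α x‖ ^ 2 / c := hMc _
      _ ≤ a * lamMax hN G * Q / c := by gcongr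
      _ = a * lamMax hN G / c * Q := by ring
      _ ≤ (1 + q) * Q := by gcongr; linarith
  have hMlower : (1 - q) * Q ≤ inner ℝ (wlap G α x) (M (wlap G α x)) :=
    calc (1 - q) * Q ≤ b * lam2 hN G / C * Q := by gcongr; linarith
      _ = b * lam2 hN G * Q / C := by ring
      _ ≤ ‖wlap G α x‖ ^ 2 / C := by gcongr
      _ ≤ _ := hMC _
  rw [abs_le]
  constructor <;> linarith

end WeightedLaplacian

section BlockDiagonal

variable {N n : ℕ} {A : Fin N → E n →L[ℝ] E n} {c C : ℝ}

/-- The block-diagonal operator with blocks `A i`; with the inverse Hessians as blocks it is the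
preconditioner of a DEAN update. -/
noncomputable def blockDiag (A : Fin N → E n →L[ℝ] E n) : Stack N n →ₗ[ℝ] Stack N n where
  toFun v := WithLp.toLp 2 fun i => A i (v i)
  map_add' x y := by ext1 i; simp
  map_smul' c x := by ext1 i; simp

theorem blockDiag_apply (A : Fin N → E n →L[ℝ] E n) (v : Stack N n) (i : Fin N) :
    blockDiag A v i = A i (v i) := rfl

theorem isSymmetric_blockDiag (hA : ∀ i, (A i : E n →ₗ[ℝ] E n).IsSymmetric) :
    (blockDiag A).IsSymmetric := by
  intro v w
  simp only [inner_stack, blockDiag_apply]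
  exact Finset.sum_congr rfl fun i _ => hA i _ _

theorem inner_blockDiag_le (h : ∀ i v, inner ℝ v (A i v) ≤ ‖v‖ ^ 2 / c) (v : Stack N n) :
    inner ℝ v (blockDiag A v) ≤ ‖v‖ ^ 2 / c := by
  rw [inner_stack, PiLp.norm_sq_eq_of_L2, Finset.sum_div]
  exact Finset.sum_le_sum fun i _ => h i _

theorem le_inner_blockDiag (h : ∀ i v, ‖v‖ ^ 2 / C ≤ inner ℝ v (A i v)) (v : Stack N n) :
    ‖v‖ ^ 2 / C ≤ inner ℝ v (blockDiag A v) := by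
  rw [inner_stack, PiLp.norm_sq_eq_of_L2, Finset.sum_div]
  exact Finset.sum_le_sum fun i _ => h i _

end BlockDiagonal

section Update

variable {N n : ℕ} {G : SimpleGraph (Fin N)} [DecidableRel G.Adj] {α : Sym2 (Fin N) → ℝ}
  {f : Fin N → E n → ℝ} {x y : Stack N n} {θ : Fin N → ℝ} {a b c C q : ℝ}

/-- `y` is obtained from `x` by one DEAN update with the surrogates `½ xᵀx`, in the inverse-free
form `∇²f_i(x_i) (y_i - x_i) = -(L_α x)_i`. -/
def IsUpdate (G : SimpleGraph (Fin N)) [DecidableRel G.Adj] (f : Fin N → E n → ℝ)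
    (α : Sym2 (Fin N) → ℝ) (x y : Stack N n) : Prop :=
  ∀ i, hess (f i) (x i) (y i - x i) = -wlap G α x i

theorem gradient_quadSurrogate (e : Sym2 (Fin N)) (z : E n) :
    gradient (quadSurrogate N n e) z = z := by
  have hderiv := ((hasFDerivAt_id z).inner ℝ (hasFDerivAt_id z)).const_mul (1 / 2 : ℝ)
  have hfderiv : fderiv ℝ (quadSurrogate N n e) z = _ := hderiv.fderiv
  refine ext_inner_right ℝ fun v => ?_
  rw [inner_gradient_left, hfderiv]
  simp [real_inner_comm]
  ring

theorem step_quadSurrogate_apply (x : Stack N n) (i : Fin N) :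
    step G f (quadSurrogate N n) α x i = x i - (hess (f i) (x i)).inverse (wlap G α x i) := by
  simp only [step, gradient_quadSurrogate, wlap_apply]
  rw [sub_eq_add_neg, ← map_neg, ← Finset.sum_neg_distrib]
  simp only [← smul_neg, neg_sub]

theorem isUpdate_step (hθ : ∀ i, 0 < θ i)
    (hlower : ∀ i v, θ i * ‖v‖ ^ 2 ≤ inner ℝ v (hess (f i) (x i) v)) :
    IsUpdate G f α x (step G f (quadSurrogate N n) α x) := fun i => by
  rw [step_quadSurrogate_apply, sub_sub_cancel_left, map_neg,
    (isInvertible_of_coercive (hθ i) (hlower i)).self_apply_inverse]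

theorem IsUpdate.eq_sub_blockDiag (h : IsUpdate G f α x y) (hc : 0 < c)
    (hlower : ∀ i v, c * ‖v‖ ^ 2 ≤ inner ℝ v (hess (f i) (x i) v)) :
    y = x - blockDiag (fun i => (hess (f i) (x i)).inverse) (wlap G α x) := by
  ext1 i
  have hinv := (isInvertible_of_coercive hc (hlower i)).inverse_apply_self (y i - x i)
  rw [PiLp.sub_apply, blockDiag_apply, ← neg_neg (wlap G α x i), ← h i, map_neg, hinv]
  abel

theorem IsUpdate.inner_wlap_self_le (h : IsUpdate G f α x y) (hN : 2 ≤ N) (hG : G.Connected)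
    (hf : ∀ i, ContDiff ℝ 2 (f i)) (hb : 0 < b) (hαb : ∀ e ∈ G.edgeSet, b ≤ α e) (ha : 0 < a)
    (hαa : ∀ e ∈ G.edgeSet, α e ≤ a) (hc : 0 < c)
    (hlower : ∀ i v, c * ‖v‖ ^ 2 ≤ inner ℝ v (hess (f i) (x i) v)) (hC : 0 < C)
    (hupper : ∀ i v, inner ℝ v (hess (f i) (x i) v) ≤ C * ‖v‖ ^ 2) (hq : 0 ≤ q)
    (hqa : a * lamMax hN G / c - 1 ≤ q) (hqb : 1 - b * lam2 hN G / C ≤ q) :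
    inner ℝ y (wlap G α y) ≤ q ^ 2 * inner ℝ x (wlap G α x) := by
  have hsymm := fun i => isSymmetric_hess (hf i) (x i)
  rw [h.eq_sub_blockDiag hc hlower]
  exact inner_sub_comp_le_sq_mul isSymmetric_wlap
    (isSymmetric_blockDiag fun i => isSymmetric_inverse (hsymm i) hc (hlower i)) hq
    (abs_inner_wlap_sub_inner_le hN hG hb hαb ha hαa hc
      (inner_blockDiag_le fun i => inner_inverse_apply_le hc (hlower i)) hC
      (le_inner_blockDiag fun i => le_inner_inverse_apply (hsymm i) hc (hlower i) hC (hupper i))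
      hqa hqb) x

theorem IsUpdate.mul_norm_sub_apply_le (h : IsUpdate G f α x y)
    (hlower : ∀ i v, θ i * ‖v‖ ^ 2 ≤ inner ℝ v (hess (f i) (x i) v)) (i : Fin N) :
    θ i * ‖y i - x i‖ ≤ ‖wlap G α x i‖ := by
  rw [← norm_neg (wlap G α x i), ← h i]
  exact mul_norm_le_norm_of_le_inner (hlower i _)

theorem IsUpdate.mul_norm_sub_le (h : IsUpdate G f α x y)
    (hlower : ∀ i v, c * ‖v‖ ^ 2 ≤ inner ℝ v (hess (f i) (x i) v)) :
    c * ‖y - x‖ ≤ ‖wlap G α x‖ := by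
  rw [← norm_neg (wlap G α x)]
  refine mul_norm_le_norm_of_le_inner ?_
  rw [inner_stack, PiLp.norm_sq_eq_of_L2, Finset.mul_sum]
  gcongr with i
  rw [PiLp.neg_apply, ← h i]
  exact hlower i _

end Update

section StepSizes

variable {N : ℕ} {G : SimpleGraph (Fin N)} {α : Sym2 (Fin N) → ℝ}

theorem le_alphaMax {e : Sym2 (Fin N)} (he : e ∈ G.edgeSet) : α e ≤ alphaMax G α :=
  le_ciSup (f := fun e : G.edgeSet => α e) (Set.finite_range _).bddAbove ⟨e, he⟩

theorem alphaMin_le {e : Sym2 (Fin N)} (he : e ∈ G.edgeSet) : alphaMin G α ≤ α e :=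
  ciInf_le (f := fun e : G.edgeSet => α e) (Set.finite_range _).bddBelow ⟨e, he⟩

theorem exists_adj (hN : 2 ≤ N) (hG : G.Connected) (i : Fin N) : ∃ j, G.Adj i j :=
  have : Nontrivial (Fin N) := Fin.nontrivial_iff_two_le.mpr hN
  hG.preconnected.exists_adj_of_nontrivial i

theorem nonempty_edgeSet (hN : 2 ≤ N) (hG : G.Connected) : Nonempty G.edgeSet :=
  have ⟨_, hadj⟩ := exists_adj hN hG ⟨0, by omega⟩
  ⟨⟨s(_, _), hadj⟩⟩

theorem exists_alphaMax_eq (hN : 2 ≤ N) (hG : G.Connected) (α : Sym2 (Fin N) → ℝ) :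
    ∃ e ∈ G.edgeSet, α e = alphaMax G α :=
  have := nonempty_edgeSet hN hG
  have ⟨e, he⟩ := exists_eq_ciSup_of_finite (f := fun e : G.edgeSet => α e)
  ⟨e, e.2, he⟩

theorem exists_alphaMin_eq (hN : 2 ≤ N) (hG : G.Connected) (α : Sym2 (Fin N) → ℝ) :
    ∃ e ∈ G.edgeSet, α e = alphaMin G α :=
  have := nonempty_edgeSet hN hG
  have ⟨e, he⟩ := exists_eq_ciInf_of_finite (f := fun e : G.edgeSet => α e)
  ⟨e, e.2, he⟩

theorem alphaMin_le_alphaMax (hN : 2 ≤ N) (hG : G.Connected) : alphaMin G α ≤ alphaMax G α :=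
  have ⟨_, he, heq⟩ := exists_alphaMax_eq hN hG α
  (alphaMin_le he).trans_eq heq

theorem alphaMin_pos (hN : 2 ≤ N) (hG : G.Connected) (hα : ∀ e ∈ G.edgeSet, 0 < α e) :
    0 < alphaMin G α :=
  have ⟨e, he, heq⟩ := exists_alphaMin_eq hN hG α
  (hα e he).trans_eq heq

theorem alphaMax_pos (hN : 2 ≤ N) (hG : G.Connected) (hα : ∀ e ∈ G.edgeSet, 0 < α e) :
    0 < alphaMax G α :=
  (alphaMin_pos hN hG hα).trans_le (alphaMin_le_alphaMax hN hG)

/-- The largest step size `max_{j ∈ N_i} α_{i,j}` over the links of node `i`. -/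
noncomputable def maxNeighborStep (G : SimpleGraph (Fin N)) (α : Sym2 (Fin N) → ℝ) (i : Fin N) :
    ℝ :=
  ⨆ j : G.neighborSet i, α s(i, (j : Fin N))

theorem le_maxNeighborStep {i j : Fin N} (hij : G.Adj i j) :
    α s(i, j) ≤ maxNeighborStep G α i :=
  le_ciSup (f := fun j : G.neighborSet i => α s(i, (j : Fin N))) (Set.finite_range _).bddAbove
    ⟨j, hij⟩

theorem exists_maxNeighborStep_eq (hN : 2 ≤ N) (hG : G.Connected) (α : Sym2 (Fin N) → ℝ)
    (i : Fin N) : ∃ j, G.Adj i j ∧ α s(i, j) = maxNeighborStep G α i :=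
  have ⟨k, hik⟩ := exists_adj hN hG i
  have : Nonempty (G.neighborSet i) := ⟨⟨k, hik⟩⟩
  have ⟨j, hj⟩ := exists_eq_ciSup_of_finite (f := fun j : G.neighborSet i => α s(i, (j : Fin N)))
  ⟨j, j.2, hj⟩

theorem maxNeighborStep_pos (hN : 2 ≤ N) (hG : G.Connected) (hα : ∀ e ∈ G.edgeSet, 0 < α e)
    (i : Fin N) : 0 < maxNeighborStep G α i :=
  have ⟨_, hij, heq⟩ := exists_maxNeighborStep_eq hN hG α i
  (hα _ hij).trans_eq heq

theorem maxNeighborStep_le_alphaMax (hN : 2 ≤ N) (hG : G.Connected) (i : Fin N) :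
    maxNeighborStep G α i ≤ alphaMax G α :=
  have ⟨_, hij, heq⟩ := exists_maxNeighborStep_eq hN hG α i
  heq ▸ le_alphaMax hij

variable [DecidableRel G.Adj] {v0 : ℝ} {θ η Θ Θ' L L' : Fin N → ℝ}

theorem degree_pos (hN : 2 ≤ N) (hG : G.Connected) (i : Fin N) : (0 : ℝ) < G.degree i :=
  Nat.cast_pos.mpr ((G.degree_pos_iff_exists_adj i).mpr (exists_adj hN hG i))

theorem rho_eq (v0 : ℝ) (θ Θ L : Fin N → ℝ) (α : Sym2 (Fin N) → ℝ) (i : Fin N) :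
    rho G v0 θ Θ L α i = θ i ^ 2 / (2 * G.degree i * maxNeighborStep G α i) -
      (Θ i - θ i / 2 + L i / 2 * √(2 * v0 / θ i)) := by
  rw [rho, maxNeighborStep]
  ring

theorem sub_half_add_pos {t T l r : ℝ} (ht : 0 < t) (htT : t ≤ T) (hl : 0 ≤ l) :
    0 < T - t / 2 + l / 2 * √r := by
  have := mul_nonneg (div_nonneg hl zero_le_two) (Real.sqrt_nonneg r)
  linarith

theorem StepSizeDrop.mono (h : StepSizeDrop G v0 θ η Θ' L' α) (hηθ : ∀ i, η i ≤ θ i)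
    (hpos : ∀ i, 0 < Θ' i - θ i / 2 + L' i / 2 * √(2 * v0 / θ i)) :
    StepSizeDrop G v0 θ θ Θ' L' α := by
  have hterm : ∀ i, stepTerm G v0 θ η Θ' L' i ≤ stepTerm G v0 θ θ Θ' L' i := fun i => by
    unfold stepTerm
    gcongr
    exacts [hpos i, hηθ i]
  exact fun i j hij => (h i j hij).trans_le (by gcongr <;> exact hterm _)

theorem StepSizeDrop.lt_div_maxNeighborStep (h : StepSizeDrop G v0 θ η Θ' L' α) (hN : 2 ≤ N)
    (hG : G.Connected) (hα : ∀ e ∈ G.edgeSet, 0 < α e) {i : Fin N}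
    (hpos : 0 < Θ' i - η i / 2 + L' i / 2 * √(2 * v0 / θ i)) :
    Θ' i - η i / 2 + L' i / 2 * √(2 * v0 / θ i) <
      θ i ^ 2 / (2 * G.degree i * maxNeighborStep G α i) := by
  obtain ⟨j, hij, heq⟩ := exists_maxNeighborStep_eq hN hG α i
  have hlt : maxNeighborStep G α i < 1 / 2 * stepTerm G v0 θ η Θ' L' i :=
    heq ▸ (h i j hij).trans_le (by gcongr; exact min_le_left _ _)
  have hdeg := degree_pos hN hG i
  have hstep := maxNeighborStep_pos hN hG hα i
  rw [stepTerm, ← div_eq_mul_inv, div_div, one_div_mul_eq_div, div_div,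
    lt_div_iff₀ (by positivity)] at hlt
  rw [lt_div_iff₀ (by positivity)]
  linarith

theorem rho_pos (hN : 2 ≤ N) (hG : G.Connected) (hα : ∀ e ∈ G.edgeSet, 0 < α e)
    (hdrop : StepSizeDrop G v0 θ θ Θ' L' α) {i : Fin N} (hθ : 0 < θ i) (hθΘ : θ i ≤ Θ i)
    (hΘ : Θ i ≤ Θ' i) (hL : 0 ≤ L i) (hLL : L i ≤ L' i) : 0 < rho G v0 θ Θ L α i := by
  rw [rho_eq, sub_pos]
  refine lt_of_le_of_lt ?_ (hdrop.lt_div_maxNeighborStep hN hG hα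
    (sub_half_add_pos hθ (hθΘ.trans hΘ) (hL.trans hLL)))
  gcongr

end StepSizes

section Rate

theorem iInf_pos_of_forall_pos {ι : Type*} [Finite ι] [Nonempty ι] {u : ι → ℝ}
    (h : ∀ i, 0 < u i) : 0 < ⨅ i, u i :=
  have ⟨i, hi⟩ := exists_eq_ciInf_of_finite (f := u)
  hi ▸ h i

theorem iInf_le_iSup_of_forall_le {ι : Type*} [Finite ι] [Nonempty ι] {u v : ι → ℝ}
    (h : ∀ i, u i ≤ v i) : (⨅ i, u i) ≤ ⨆ i, v i :=
  have i := Classical.arbitrary ι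
  (ciInf_le (Set.finite_range u).bddBelow i).trans
    ((h i).trans (le_ciSup (Set.finite_range v).bddAbove i))

variable {N : ℕ} {G : SimpleGraph (Fin N)} [DecidableRel G.Adj] {α : Sym2 (Fin N) → ℝ}
  {θ Θ : Fin N → ℝ}

theorem alphaMin_mul_lam2_le (hN : 2 ≤ N) (hG : G.Connected) (hα : ∀ e ∈ G.edgeSet, 0 < α e) :
    alphaMin G α * lam2 hN G ≤ alphaMax G α * lamMax hN G :=
  mul_le_mul (alphaMin_le_alphaMax hN hG) (lam2_le_lamMax hN) (lam2_pos hN hG).le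
    (alphaMax_pos hN hG hα).le

theorem rate_nonneg (hN : 2 ≤ N) (hG : G.Connected) (hα : ∀ e ∈ G.edgeSet, 0 < α e)
    (hθ : 0 < ⨅ i, θ i) (hθΘ : (⨅ i, θ i) ≤ ⨆ i, Θ i) : 0 ≤ rate hN G θ Θ α := by
  have hle : alphaMin G α * lam2 hN G / (⨆ i, Θ i) ≤ alphaMax G α * lamMax hN G / (⨅ i, θ i) :=
    div_le_div₀ (mul_nonneg (alphaMax_pos hN hG hα).le
      ((lam2_pos hN hG).le.trans (lam2_le_lamMax hN))) (alphaMin_mul_lam2_le hN hG hα) hθ hθΘ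
  by_contra! hneg
  obtain ⟨hfst, hsnd⟩ := max_lt_iff.mp hneg
  linarith

theorem rate_lt_one (hN : 2 ≤ N) (hG : G.Connected) (hα : ∀ e ∈ G.edgeSet, 0 < α e)
    (hθ : 0 < ⨅ i, θ i) (hΘ : 0 < ⨆ i, Θ i)
    (hαθ : ∀ e ∈ G.edgeSet, α e < (⨅ i, θ i) / (G.maxDegree : ℝ)) : rate hN G θ Θ α < 1 := by
  have hdeg : (0 : ℝ) < G.maxDegree := (degree_pos hN hG ⟨0, by omega⟩).trans_le
    (Nat.cast_le.mpr (G.degree_le_maxDegree _))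
  have hαmax : alphaMax G α * G.maxDegree < ⨅ i, θ i := by
    obtain ⟨e, he, heq⟩ := exists_alphaMax_eq hN hG α
    exact heq ▸ (lt_div_iff₀ hdeg).mp (hαθ e he)
  refine max_lt ?_ (sub_lt_self _
    (div_pos (mul_pos (alphaMin_pos hN hG hα) (lam2_pos hN hG)) hΘ))
  rw [sub_lt_iff_lt_add, div_lt_iff₀ hθ]
  calc alphaMax G α * lamMax hN G ≤ alphaMax G α * (2 * G.maxDegree) :=
        mul_le_mul_of_nonneg_left (lamMax_le_two_mul_maxDegree hN) (alphaMax_pos hN hG hα).le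
    _ < (1 + 1) * ⨅ i, θ i := by linarith

theorem eq_top_of_rate_eq_zero (hN : 2 ≤ N) (hG : G.Connected) (hα : ∀ e ∈ G.edgeSet, 0 < α e)
    (hθ : 0 < ⨅ i, θ i) (hθΘ : (⨅ i, θ i) ≤ ⨆ i, Θ i) (h : rate hN G θ Θ α = 0) :
    G = ⊤ ∧ (⨅ i, θ i) = (⨆ i, Θ i) ∧ ∀ e ∈ G.edgeSet, α e = (⨅ i, θ i) / N := by
  have hmin := alphaMin_pos hN hG hα
  have hlamMax := (lam2_pos hN hG).trans_le (lam2_le_lamMax hN)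
  obtain ⟨hfst, hsnd⟩ := max_le_iff.mp h.le
  rw [sub_nonpos, div_le_one hθ] at hfst
  rw [sub_nonpos, one_le_div (hθ.trans_le hθΘ)] at hsnd
  have hmid : alphaMin G α * lam2 hN G ≤ alphaMin G α * lamMax hN G :=
    mul_le_mul_of_nonneg_left (lam2_le_lamMax hN) hmin.le
  have hmid' : alphaMin G α * lamMax hN G ≤ alphaMax G α * lamMax hN G :=
    mul_le_mul_of_nonneg_right (alphaMin_le_alphaMax hN hG) hlamMax.le
  have hαeq : alphaMin G α = alphaMax G α := mul_right_cancel₀ hlamMax.ne' (by linarith)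
  obtain ⟨htop, hlamMax_eq⟩ :=
    eq_top_of_lam2_eq_lamMax hN hG (mul_left_cancel₀ hmin.ne' (by linarith))
  refine ⟨htop, by linarith, fun e he => ?_⟩
  rw [le_antisymm (le_alphaMax (α := α) he) (hαeq ▸ alphaMin_le he),
    eq_div_iff (hlamMax_eq ▸ hlamMax.ne'), ← hlamMax_eq]
  linarith

end Rate

section Lyapunov

variable {N n : ℕ} {f : Fin N → E n → ℝ} {xs : E n} {x x0 y : Stack N n}

theorem V_nonneg (hconv : ∀ i, ConvexOn ℝ Set.univ (f i)) (hf : ∀ i, Differentiable ℝ (f i))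
    (xs : E n) (x : Stack N n) : 0 ≤ V f xs x :=
  Finset.sum_nonneg fun i _ => bregman_nonneg (hconv i) (hf i) _ _

theorem mem_Cset_of_V_le (hconv : ∀ i, ConvexOn ℝ Set.univ (f i))
    (hf : ∀ i, Differentiable ℝ (f i)) (h : V f xs x ≤ V f xs x0) (i : Fin N) :
    x i ∈ Cset f xs x0 i :=
  (Finset.single_le_sum (f := fun i => bregman (f i) xs (x i))
    (fun i _ => bregman_nonneg (hconv i) (hf i) _ _) (Finset.mem_univ i)).trans h

theorem optimum_mem_Cset (h : 0 ≤ V f xs x0) (i : Fin N) : xs ∈ Cset f xs x0 i := by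
  simpa [Cset, bregman] using h

theorem norm_sub_le_of_mem_Cset {i : Fin N} (hf : ContDiff ℝ 2 (f i)) (hV : 0 ≤ V f xs x0)
    {t : ℝ} (ht : 0 < t) (hlower : HessLowerBound (f i) (convexHull ℝ (Cset f xs x0 i)) t)
    {z : E n} (hz : z ∈ Cset f xs x0 i) : ‖z - xs‖ ≤ √(2 * V f xs x0 / t) := by
  have hquad : t / 2 * ‖xs - z‖ ^ 2 ≤ V f xs x0 :=
    (hlower.le_bregman hf (convex_convexHull ℝ _) (subset_convexHull ℝ _ hz)
      (subset_convexHull ℝ _ (optimum_mem_Cset hV i))).trans hz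
  rw [norm_sub_rev]
  apply Real.le_sqrt_of_sq_le
  rw [le_div_iff₀ ht]
  linarith

theorem bregman_sub_bregman (g : E n → ℝ) (p u w : E n) :
    bregman g p w - bregman g p u = bregman g u w + inner ℝ (hess g u (w - u)) (u - p) +
      inner ℝ (gradient g w - gradient g u - hess g u (w - u)) (u - p) := by
  simp only [bregman, inner_sub_left, inner_sub_right]
  ring

theorem bregman_sub_bregman_le {g : E n → ℝ} (hg : ContDiff ℝ 2 g) {S : Set (E n)}
    (hS : Convex ℝ S) {c l r : ℝ} (hc : HessUpperBound g S c) (hl : HessLipschitz g S l)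
    (hl0 : 0 ≤ l) {u w p : E n} (hu : u ∈ S) (hw : w ∈ S) (hr : ‖u - p‖ ≤ r) :
    bregman g p w - bregman g p u ≤
      inner ℝ (hess g u (w - u)) (u - p) + (c / 2 + l / 2 * r) * ‖w - u‖ ^ 2 := by
  have hbregman : bregman g u w ≤ c / 2 * ‖w - u‖ ^ 2 :=
    norm_sub_rev u w ▸ hc.bregman_le hg hS hw hu
  have hremainder : inner ℝ (gradient g w - gradient g u - hess g u (w - u)) (u - p) ≤
      l / 2 * ‖w - u‖ ^ 2 * r :=
    (real_inner_le_norm _ _).trans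
      (by gcongr; exact hl.norm_gradient_remainder_le hg hS hu hw)
  rw [bregman_sub_bregman]
  linarith

variable {G : SimpleGraph (Fin N)} [DecidableRel G.Adj] {α : Sym2 (Fin N) → ℝ}
  {θ Θ Θ' C L L' r : Fin N → ℝ} {S : Fin N → Set (E n)}

theorem IsUpdate.V_le (h : IsUpdate G f α x y) (hf : ∀ i, ContDiff ℝ 2 (f i))
    (hS : ∀ i, Convex ℝ (S i)) (hC : ∀ i, HessUpperBound (f i) (S i) (C i))
    (hL0 : ∀ i, 0 ≤ L i) (hL : ∀ i, HessLipschitz (f i) (S i) (L i)) (hx : ∀ i, x i ∈ S i)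
    (hy : ∀ i, y i ∈ S i) (hr : ∀ i, ‖x i - xs‖ ≤ r i) :
    V f xs y ≤ V f xs x - inner ℝ x (wlap G α x) +
      ∑ i, (C i / 2 + L i / 2 * r i) * ‖y i - x i‖ ^ 2 := by
  have hfirst : ∑ i, inner ℝ (hess (f i) (x i) (y i - x i)) (x i - xs) =
      -inner ℝ x (wlap G α x) := by
    simp only [h _, inner_neg_left, inner_sub_right, Finset.sum_neg_distrib,
      Finset.sum_sub_distrib]
    rw [← sum_inner, sum_wlap_apply, inner_zero_left, neg_zero, sub_zero, ← inner_stack,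
      real_inner_comm]
  have hsum := Finset.sum_le_sum fun i (_ : i ∈ Finset.univ) =>
    bregman_sub_bregman_le (hf i) (hS i) (hC i) (hL i) (hL0 i) (hx i) (hy i) (hr i)
  rw [Finset.sum_sub_distrib, Finset.sum_add_distrib, hfirst] at hsum
  unfold V
  linarith

theorem norm_wlap_apply_sq_le (hα : ∀ e ∈ G.edgeSet, 0 ≤ α e) (x : Stack N n) (i : Fin N) :
    ‖wlap G α x i‖ ^ 2 ≤ G.degree i * maxNeighborStep G α i *
      ∑ j ∈ G.neighborFinset i, α s(i, j) * ‖x i - x j‖ ^ 2 := by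
  have hα' : ∀ j ∈ G.neighborFinset i, 0 ≤ α s(i, j) := fun j hj => hα _ (by simpa using hj)
  calc ‖wlap G α x i‖ ^ 2 ≤ (∑ j ∈ G.neighborFinset i, α s(i, j) * ‖x i - x j‖) ^ 2 := by
        gcongr
        exact norm_wlap_apply_le hα x i
    _ ≤ G.degree i * ∑ j ∈ G.neighborFinset i, (α s(i, j) * ‖x i - x j‖) ^ 2 := by
        rw [← G.card_neighborFinset_eq_degree]
        exact sq_sum_le_card_mul_sum_sq
    _ ≤ G.degree i *
        ∑ j ∈ G.neighborFinset i, maxNeighborStep G α i * (α s(i, j) * ‖x i - x j‖ ^ 2) := by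
        gcongr with j hj
        rw [mul_pow, sq (α _), mul_assoc]
        exact mul_le_mul_of_nonneg_right (le_maxNeighborStep (by simpa using hj))
          (mul_nonneg (hα' j hj) (sq_nonneg _))
    _ = _ := by rw [← Finset.mul_sum, mul_assoc]

theorem IsUpdate.sum_mul_norm_sub_sq_le (h : IsUpdate G f α x y) (hN : 2 ≤ N)
    (hG : G.Connected) (hα : ∀ e ∈ G.edgeSet, 0 < α e) (hθ : ∀ i, 0 < θ i)
    (hlower : ∀ i v, θ i * ‖v‖ ^ 2 ≤ inner ℝ v (hess (f i) (x i) v)) :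
    ∑ i, θ i ^ 2 / (2 * G.degree i * maxNeighborStep G α i) * ‖y i - x i‖ ^ 2 ≤
      inner ℝ x (wlap G α x) := by
  rw [inner_wlap_self, Finset.mul_sum]
  refine Finset.sum_le_sum fun i _ => ?_
  have hstep := maxNeighborStep_pos hN hG hα i
  have hdeg := degree_pos hN hG i
  rw [div_mul_eq_mul_div, div_le_iff₀ (by positivity)]
  calc θ i ^ 2 * ‖y i - x i‖ ^ 2 = (θ i * ‖y i - x i‖) ^ 2 := (mul_pow _ _ _).symm
    _ ≤ ‖wlap G α x i‖ ^ 2 :=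
        pow_le_pow_left₀ (mul_nonneg (hθ i).le (norm_nonneg _)) (h.mul_norm_sub_apply_le hlower i) 2
    _ ≤ _ := norm_wlap_apply_sq_le (fun e he => (hα e he).le) x i
    _ = _ := by ring

theorem IsUpdate.V_add_sum_le (h : IsUpdate G f α x y) (hN : 2 ≤ N) (hG : G.Connected)
    (hα : ∀ e ∈ G.edgeSet, 0 < α e) (hf : ∀ i, ContDiff ℝ 2 (f i)) (hθ : ∀ i, 0 < θ i)
    (hlower : ∀ i v, θ i * ‖v‖ ^ 2 ≤ inner ℝ v (hess (f i) (x i) v))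
    (hS : ∀ i, Convex ℝ (S i)) (hC : ∀ i, HessUpperBound (f i) (S i) (C i))
    (hL0 : ∀ i, 0 ≤ L i) (hL : ∀ i, HessLipschitz (f i) (S i) (L i)) (hx : ∀ i, x i ∈ S i)
    (hy : ∀ i, y i ∈ S i) (hr : ∀ i, ‖x i - xs‖ ≤ r i) :
    V f xs y + ∑ i, (θ i ^ 2 / (2 * G.degree i * maxNeighborStep G α i) -
      (C i / 2 + L i / 2 * r i)) * ‖y i - x i‖ ^ 2 ≤ V f xs x := by
  have henergy := h.sum_mul_norm_sub_sq_le hN hG hα hθ hlower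
  have hdrop := h.V_le hf hS hC hL0 hL hx hy hr
  simp only [sub_mul, Finset.sum_sub_distrib]
  linarith

theorem IsUpdate.norm_sub_apply_le_delta {αbar : ℝ} (h : IsUpdate G f α x y)
    (hα : ∀ e ∈ G.edgeSet, 0 ≤ α e) (hαbar : ∀ e ∈ G.edgeSet, α e ≤ αbar)
    (hf : ∀ i, ContDiff ℝ 2 (f i)) (hV : 0 ≤ V f xs x0) (hθ : ∀ i, 0 < θ i)
    (hlower : ∀ i, HessLowerBound (f i) (convexHull ℝ (Cset f xs x0 i)) (θ i))
    (hx : ∀ i, x i ∈ Cset f xs x0 i) (i : Fin N) :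
    ‖y i - x i‖ ≤ delta G αbar (V f xs x0) θ i := by
  have hdist : ∀ j, ‖x i - x j‖ ≤ √(2 * V f xs x0 / θ i) + √(2 * V f xs x0 / θ j) := fun j => by
    rw [← sub_sub_sub_cancel_right (x i) (x j) xs]
    exact (norm_sub_le _ _).trans (add_le_add
      (norm_sub_le_of_mem_Cset (hf i) hV (hθ i) (hlower i) (hx i))
      (norm_sub_le_of_mem_Cset (hf j) hV (hθ j) (hlower j) (hx j)))
  have hwlap : ‖wlap G α x i‖ ≤ ∑ j ∈ G.neighborFinset i,
      αbar * (√(2 * V f xs x0 / θ i) + √(2 * V f xs x0 / θ j)) :=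
    (norm_wlap_apply_le hα x i).trans (Finset.sum_le_sum fun j hj => by
      have he : s(i, j) ∈ G.edgeSet := by simpa using hj
      exact mul_le_mul (hαbar _ he) (hdist j) (norm_nonneg _) ((hα _ he).trans (hαbar _ he)))
  rw [delta, div_mul_eq_mul_div, Finset.mul_sum, le_div_iff₀' (hθ i)]
  exact (h.mul_norm_sub_apply_le
    (fun i => hlower i _ (subset_convexHull ℝ _ (hx i))) i).trans hwlap

theorem IsUpdate.V_le_of_stepSizeDrop {αbar : ℝ} (h : IsUpdate G f α x y) (hN : 2 ≤ N)
    (hG : G.Connected) (hα : ∀ e ∈ G.edgeSet, 0 < α e) (hαbar : ∀ e ∈ G.edgeSet, α e ≤ αbar)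
    (hdrop : StepSizeDrop G (V f xs x0) θ θ Θ' L' α) (hf : ∀ i, ContDiff ℝ 2 (f i))
    (hV : 0 ≤ V f xs x0) (hθ : ∀ i, 0 < θ i)
    (hlower : ∀ i, HessLowerBound (f i) (convexHull ℝ (Cset f xs x0 i)) (θ i))
    (hθΘ' : ∀ i, θ i ≤ Θ' i) (hΘ' : ∀ i, HessUpperBound (f i) (Cset' G f xs x0 αbar θ i) (Θ' i))
    (hL0 : ∀ i, 0 ≤ L' i) (hL' : ∀ i, HessLipschitz (f i) (Cset' G f xs x0 αbar θ i) (L' i))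
    (hx : ∀ i, x i ∈ Cset f xs x0 i) : V f xs y ≤ V f xs x := by
  have hδ := h.norm_sub_apply_le_delta (fun e he => (hα e he).le) hαbar hf hV hθ hlower hx
  have hx' : ∀ i, x i ∈ Cset' G f xs x0 αbar θ i := fun i =>
    subset_convexHull ℝ _ ⟨x i, hx i, by simpa using (norm_nonneg _).trans (hδ i)⟩
  have hy' : ∀ i, y i ∈ Cset' G f xs x0 αbar θ i := fun i =>
    subset_convexHull ℝ _ ⟨x i, hx i, hδ i⟩
  refine le_trans (le_add_of_nonneg_right (Finset.sum_nonneg fun i _ => mul_nonneg ?_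
    (sq_nonneg _))) (h.V_add_sum_le hN hG hα hf hθ
      (fun i => hlower i _ (subset_convexHull ℝ _ (hx i))) (fun i => convex_convexHull ℝ _) hΘ'
      hL0 hL' hx' hy' fun i => norm_sub_le_of_mem_Cset (hf i) hV (hθ i) (hlower i) (hx i))
  have hlt := hdrop.lt_div_maxNeighborStep hN hG hα
    (sub_half_add_pos (hθ i) (hθΘ' i) (hL0 i))
  linarith [hθΘ' i]

theorem IsUpdate.V_add_sum_rho_le (h : IsUpdate G f α x y) (hN : 2 ≤ N) (hG : G.Connected)
    (hα : ∀ e ∈ G.edgeSet, 0 < α e) (hf : ∀ i, ContDiff ℝ 2 (f i)) (hV : 0 ≤ V f xs x0)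
    (hθ : ∀ i, 0 < θ i)
    (hlower : ∀ i, HessLowerBound (f i) (convexHull ℝ (Cset f xs x0 i)) (θ i))
    (hθΘ : ∀ i, θ i ≤ Θ i)
    (hΘ : ∀ i, HessUpperBound (f i) (convexHull ℝ (Cset f xs x0 i)) (Θ i))
    (hL0 : ∀ i, 0 ≤ L i) (hL : ∀ i, HessLipschitz (f i) (convexHull ℝ (Cset f xs x0 i)) (L i))
    (hx : ∀ i, x i ∈ Cset f xs x0 i) (hy : ∀ i, y i ∈ Cset f xs x0 i) :
    V f xs y + ∑ i, rho G (V f xs x0) θ Θ L α i * ‖y i - x i‖ ^ 2 ≤ V f xs x := by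
  refine le_trans ?_ (h.V_add_sum_le hN hG hα hf hθ
    (fun i => hlower i _ (subset_convexHull ℝ _ (hx i))) (fun i => convex_convexHull ℝ _) hΘ hL0 hL
    (fun i => subset_convexHull ℝ _ (hx i)) (fun i => subset_convexHull ℝ _ (hy i))
    fun i => norm_sub_le_of_mem_Cset (hf i) hV (hθ i) (hlower i) (hx i))
  gcongr with i
  rw [rho_eq]
  linarith [hθΘ i]

end Lyapunov

section Convergence

variable {N n : ℕ} {G : SimpleGraph (Fin N)} [DecidableRel G.Adj] {α : Sym2 (Fin N) → ℝ}
  {x : ℕ → Stack N n} {a c q : ℝ}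

theorem continuous_inner_wlap_self (G : SimpleGraph (Fin N)) [DecidableRel G.Adj]
    (α : Sym2 (Fin N) → ℝ) : Continuous fun x : Stack N n => inner ℝ x (wlap G α x) := by
  simp only [inner_wlap_self]
  fun_prop

theorem inner_wlap_self_le_geometric (hN : 2 ≤ N) (ha : 0 ≤ a) (hαa : ∀ e ∈ G.edgeSet, α e ≤ a)
    (henergy : ∀ k, inner ℝ (x (k + 1)) (wlap G α (x (k + 1))) ≤
      q ^ 2 * inner ℝ (x k) (wlap G α (x k))) (k : ℕ) :
    inner ℝ (x k) (wlap G α (x k)) ≤ a * lamMax hN G * (‖x 0‖ * q ^ k) ^ 2 := by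
  induction k with
  | zero => simpa using inner_wlap_self_le hN ha hαa (x 0)
  | succ k ih =>
    calc _ ≤ q ^ 2 * inner ℝ (x k) (wlap G α (x k)) := henergy k
      _ ≤ q ^ 2 * (a * lamMax hN G * (‖x 0‖ * q ^ k) ^ 2) := by gcongr
      _ = _ := by ring

theorem norm_wlap_le_geometric (hN : 2 ≤ N) (hG : G.Connected) (hα : ∀ e ∈ G.edgeSet, 0 ≤ α e)
    (ha : 0 < a) (hαa : ∀ e ∈ G.edgeSet, α e ≤ a) (hq : 0 ≤ q)
    (henergy : ∀ k, inner ℝ (x (k + 1)) (wlap G α (x (k + 1))) ≤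
      q ^ 2 * inner ℝ (x k) (wlap G α (x k))) (k : ℕ) :
    ‖wlap G α (x k)‖ ≤ a * lamMax hN G * (‖x 0‖ * q ^ k) := by
  have hlam : 0 < lamMax hN G := (lam2_pos hN hG).trans_le (lam2_le_lamMax hN)
  refine le_of_sq_le_sq ?_ (by positivity)
  calc ‖wlap G α (x k)‖ ^ 2 ≤ a * lamMax hN G * inner ℝ (x k) (wlap G α (x k)) :=
        norm_wlap_sq_le hN hG ha hα hαa (x k)
    _ ≤ a * lamMax hN G * (a * lamMax hN G * (‖x 0‖ * q ^ k) ^ 2) := by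
        gcongr
        exact inner_wlap_self_le_geometric hN ha.le hαa henergy k
    _ = _ := by ring

theorem exists_tendsto_consensus (hN : 2 ≤ N) (hG : G.Connected)
    (hα : ∀ e ∈ G.edgeSet, 0 < α e) (hc : 0 < c) (hq0 : 0 ≤ q) (hq1 : q < 1)
    (henergy : ∀ k, inner ℝ (x (k + 1)) (wlap G α (x (k + 1))) ≤
      q ^ 2 * inner ℝ (x k) (wlap G α (x k)))
    (hdisp : ∀ k, c * ‖x (k + 1) - x k‖ ≤ ‖wlap G α (x k)‖) :
    ∃ z : E n, Filter.Tendsto x Filter.atTop (nhds (consensus N z)) ∧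
      ∀ k, ‖x k - consensus N z‖ ≤
        alphaMax G α * lamMax hN G / (c * (1 - q)) * ‖x 0‖ * q ^ k := by
  have hα0 : ∀ e ∈ G.edgeSet, 0 ≤ α e := fun e he => (hα e he).le
  have hmax := alphaMax_pos hN hG hα
  have hdist : ∀ k, dist (x k) (x (k + 1)) ≤
      alphaMax G α * lamMax hN G / c * ‖x 0‖ * q ^ k := fun k => by
    rw [dist_comm, dist_eq_norm, div_mul_eq_mul_div, div_mul_eq_mul_div, le_div_iff₀' hc, mul_assoc]
    exact (hdisp k).trans (norm_wlap_le_geometric hN hG hα0 hmax (fun _ => le_alphaMax) hq0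
      henergy k)
  obtain ⟨y, hy⟩ := cauchySeq_tendsto_of_complete (cauchySeq_of_le_geometric q _ hq1 hdist)
  have hbound_tendsto : Filter.Tendsto
      (fun k => alphaMax G α * lamMax hN G * (‖x 0‖ * q ^ k) ^ 2) Filter.atTop (nhds 0) := by
    simpa using (((tendsto_pow_atTop_nhds_zero_of_lt_one hq0 hq1).const_mul ‖x 0‖).pow 2).const_mul
      (alphaMax G α * lamMax hN G)
  have henergy_zero : inner ℝ y (wlap G α y) = 0 :=
    (le_of_tendsto_of_tendsto' (((continuous_inner_wlap_self G α).tendsto y).comp hy)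
      hbound_tendsto (inner_wlap_self_le_geometric hN hmax.le (fun _ => le_alphaMax)
        henergy)).antisymm (inner_wlap_self_nonneg hα0 y)
  have hcons : y = consensus N (average y) :=
    eq_consensus_of_inner_wlap_self_eq_zero hN hG (alphaMin_pos hN hG hα)
      (fun _ => alphaMin_le) henergy_zero
  refine ⟨average y, hcons ▸ hy, fun k => ?_⟩
  rw [← hcons, ← dist_eq_norm, ← div_div, div_mul_eq_mul_div, div_mul_eq_mul_div]
  exact dist_le_of_le_geometric_of_tendsto q _ hq1 hdist hy k

theorem exists_tendsto_consensus_of_isUpdate {f : Fin N → E n → ℝ} {θ Θ : Fin N → ℝ}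
    (hx : ∀ k, IsUpdate G f α (x k) (x (k + 1))) (hN : 2 ≤ N) (hG : G.Connected)
    (hα : ∀ e ∈ G.edgeSet, 0 < α e) (hf : ∀ i, ContDiff ℝ 2 (f i))
    (hθ : 0 < ⨅ i, θ i) (hΘ : 0 < ⨆ i, Θ i)
    (hlower : ∀ k i v, θ i * ‖v‖ ^ 2 ≤ inner ℝ v (hess (f i) (x k i) v))
    (hupper : ∀ k i v, inner ℝ v (hess (f i) (x k i) v) ≤ Θ i * ‖v‖ ^ 2)
    (hq0 : 0 ≤ rate hN G θ Θ α) (hq1 : rate hN G θ Θ α < 1) :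
    ∃ z : E n, Filter.Tendsto x Filter.atTop (nhds (consensus N z)) ∧
      ∀ k, ‖x k - consensus N z‖ ≤
        alphaMax G α * lamMax hN G / ((⨅ i, θ i) * (1 - rate hN G θ Θ α)) * ‖x 0‖ *
          rate hN G θ Θ α ^ k := by
  have hlower' : ∀ k i v, (⨅ i, θ i) * ‖v‖ ^ 2 ≤ inner ℝ v (hess (f i) (x k i) v) := fun k i v =>
    le_trans (by gcongr; exact ciInf_le (Set.finite_range θ).bddBelow i) (hlower k i v)
  have hupper' : ∀ k i v, inner ℝ v (hess (f i) (x k i) v) ≤ (⨆ i, Θ i) * ‖v‖ ^ 2 := fun k i v =>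
    (hupper k i v).trans (by gcongr; exact le_ciSup (Set.finite_range Θ).bddAbove i)
  exact exists_tendsto_consensus hN hG hα hθ hq0 hq1
    (fun k => (hx k).inner_wlap_self_le hN hG hf (alphaMin_pos hN hG hα) (fun _ => alphaMin_le)
      (alphaMax_pos hN hG hα) (fun _ => le_alphaMax) hθ (hlower' k) hΘ (hupper' k) hq0
      (le_max_left _ _) (le_max_right _ _))
    fun k => (hx k).mul_norm_sub_le (hlower' k)

end Convergence

section Optimality

theorem sum_mul_le_iSup_div_mul_sum {ι : Type*} [Fintype ι] {l ρ s : ι → ℝ} (hρ : ∀ i, 0 < ρ i)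
    (hs : ∀ i, 0 ≤ s i) : ∑ i, l i * s i ≤ (⨆ i, l i / ρ i) * ∑ i, ρ i * s i := by
  rw [Finset.mul_sum]
  refine Finset.sum_le_sum fun i _ => ?_
  rw [← mul_assoc]
  exact mul_le_mul_of_nonneg_right ((div_le_iff₀ (hρ i)).mp
    (le_ciSup (f := fun i => l i / ρ i) (Set.finite_range _).bddAbove i)) (hs i)

theorem norm_le_mul_sub_of_norm_sub_le {F : Type*} [SeminormedAddCommGroup F] {u : ℕ → F}
    {v : ℕ → ℝ} {R : ℝ} (hzero : u 0 = 0)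
    (hstep : ∀ k, ‖u (k + 1) - u k‖ ≤ R * (v k - v (k + 1))) (k : ℕ) :
    ‖u k‖ ≤ R * (v 0 - v k) := by
  have htelescope := norm_sum_le_of_le (Finset.range k) fun j _ => hstep j
  rwa [Finset.sum_range_sub, hzero, sub_zero, ← Finset.mul_sum, Finset.sum_range_sub'] at htelescope

variable {N n : ℕ} {G : SimpleGraph (Fin N)} [DecidableRel G.Adj] {α : Sym2 (Fin N) → ℝ}
  {f : Fin N → E n → ℝ} {xs : E n} {x0 y : Stack N n} {θ Θ L θbar : Fin N → ℝ}

/-- The first-order variations of the local gradients sum to zero over the network, so only the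
Taylor remainders contribute to the drift of the summed gradient. -/
theorem IsUpdate.norm_sum_gradient_sub_le {x : Stack N n} (h : IsUpdate G f α x y)
    (hf : ∀ i, ContDiff ℝ 2 (f i)) {S : Fin N → Set (E n)} (hS : ∀ i, Convex ℝ (S i))
    (hL : ∀ i, HessLipschitz (f i) (S i) (L i)) (hx : ∀ i, x i ∈ S i) (hy : ∀ i, y i ∈ S i) :
    ‖∑ i, gradient (f i) (y i) - ∑ i, gradient (f i) (x i)‖ ≤ ∑ i, L i / 2 * ‖y i - x i‖ ^ 2 := by
  have hremainder : ∑ i, gradient (f i) (y i) - ∑ i, gradient (f i) (x i) =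
      ∑ i, (gradient (f i) (y i) - gradient (f i) (x i) - hess (f i) (x i) (y i - x i)) := by
    simp only [h _, Finset.sum_sub_distrib, Finset.sum_neg_distrib, sum_wlap_apply, neg_zero,
      sub_zero]
  rw [hremainder]
  exact norm_sum_le_of_le _ fun i _ =>
    (hL i).norm_gradient_remainder_le (hf i) (hS i) (hx i) (hy i)

theorem IsUpdate.norm_sum_gradient_sub_le_mul_V_sub {x : Stack N n} (h : IsUpdate G f α x y)
    (hN : 2 ≤ N) (hG : G.Connected) (hα : ∀ e ∈ G.edgeSet, 0 < α e)
    (hf : ∀ i, ContDiff ℝ 2 (f i)) (hV : 0 ≤ V f xs x0) (hθ : ∀ i, 0 < θ i)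
    (hlower : ∀ i, HessLowerBound (f i) (convexHull ℝ (Cset f xs x0 i)) (θ i))
    (hθΘ : ∀ i, θ i ≤ Θ i)
    (hΘ : ∀ i, HessUpperBound (f i) (convexHull ℝ (Cset f xs x0 i)) (Θ i))
    (hL0 : ∀ i, 0 ≤ L i) (hL : ∀ i, HessLipschitz (f i) (convexHull ℝ (Cset f xs x0 i)) (L i))
    (hρ : ∀ i, 0 < rho G (V f xs x0) θ Θ L α i)
    (hx : ∀ i, x i ∈ Cset f xs x0 i) (hy : ∀ i, y i ∈ Cset f xs x0 i) :
    ‖∑ i, gradient (f i) (y i) - ∑ i, gradient (f i) (x i)‖ ≤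
      (⨆ i, L i / rho G (V f xs x0) θ Θ L α i) / 2 * (V f xs x - V f xs y) := by
  have hR : 0 ≤ ⨆ i, L i / rho G (V f xs x0) θ Θ L α i :=
    Real.iSup_nonneg fun i => div_nonneg (hL0 i) (hρ i).le
  set R := ⨆ i, L i / rho G (V f xs x0) θ Θ L α i
  calc _ ≤ ∑ i, L i / 2 * ‖y i - x i‖ ^ 2 :=
        h.norm_sum_gradient_sub_le hf (fun i => convex_convexHull ℝ _) hL
          (fun i => subset_convexHull ℝ _ (hx i)) fun i => subset_convexHull ℝ _ (hy i)
    _ = (∑ i, L i * ‖y i - x i‖ ^ 2) / 2 := by simp only [Finset.sum_div, div_mul_eq_mul_div]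
    _ ≤ R * (∑ i, rho G (V f xs x0) θ Θ L α i * ‖y i - x i‖ ^ 2) / 2 := by
        gcongr
        exact sum_mul_le_iSup_div_mul_sum hρ fun i => sq_nonneg _
    _ ≤ R * (V f xs x - V f xs y) / 2 := by
        gcongr
        exact le_sub_iff_add_le'.mpr
          (h.V_add_sum_rho_le hN hG hα hf hV hθ hlower hθΘ hΘ hL0 hL hx hy)
    _ = _ := by ring

theorem norm_sum_gradient_le_of_tendsto {x : ℕ → Stack N n} {z : E n} {R : ℝ}
    (hz : Filter.Tendsto x Filter.atTop (nhds (consensus N z)))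
    (hf : ∀ i, ContDiff ℝ 2 (f i)) (hzero : ∑ i, gradient (f i) (x 0 i) = 0) (hR : 0 ≤ R)
    (hV : ∀ k, 0 ≤ V f xs (x k))
    (hdrift : ∀ k, ‖∑ i, gradient (f i) (x (k + 1) i) - ∑ i, gradient (f i) (x k i)‖ ≤
      R * (V f xs (x k) - V f xs (x (k + 1)))) :
    ‖∑ i, gradient (f i) z‖ ≤ R * V f xs (x 0) := by
  have hzi : ∀ i, Filter.Tendsto (fun k => x k i) Filter.atTop (nhds z) :=
    fun i => ((PiLp.continuous_apply 2 (fun _ => E n) i).tendsto _).comp hz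
  refine le_of_tendsto' (tendsto_finsetSum _ fun i _ =>
    ((contDiff_gradient (hf i)).continuous.tendsto z).comp (hzi i)).norm fun k => ?_
  refine (norm_le_mul_sub_of_norm_sub_le (u := fun k => ∑ i, gradient (f i) (x k i))
    (v := fun k => V f xs (x k)) hzero hdrift k).trans ?_
  gcongr
  exact sub_le_self _ (hV k)

theorem mem_Cset_of_tendsto {x : ℕ → Stack N n} {z : E n}
    (hz : Filter.Tendsto x Filter.atTop (nhds (consensus N z))) {i : Fin N}
    (hf : ContDiff ℝ 2 (f i)) (hmem : ∀ k, x k i ∈ Cset f xs x0 i) : z ∈ Cset f xs x0 i :=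
  (isClosed_le (continuous_bregman hf xs) continuous_const).mem_of_tendsto
    (((PiLp.continuous_apply 2 (fun _ => E n) i).tendsto _).comp hz) (.of_forall hmem)

theorem sum_gradient_eq_zero_of_isMinOn (hf : ∀ i, Differentiable ℝ (f i))
    (hxs : IsMinOn (fun x => ∑ i, f i x) Set.univ xs) : ∑ i, gradient (f i) xs = 0 := by
  rw [← gradient_eq_zero_of_isMinOn hxs]
  refine ext_inner_right ℝ fun v => ?_
  rw [inner_gradient_left, sum_inner, fderiv_fun_sum fun i _ => hf i xs, sum_apply]
  simp only [inner_gradient_left]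

theorem sum_mul_norm_sub_le_norm_sum_gradient (hf : ∀ i, ContDiff ℝ 2 (f i)) {S : Set (E n)}
    (hS : Convex ℝ S) (hθbar : ∀ i, HessLowerBound (f i) S (θbar i))
    (hxs : ∑ i, gradient (f i) xs = 0) (hxsS : xs ∈ S) {z : E n} (hz : z ∈ S) :
    (∑ i, θbar i) * ‖z - xs‖ ≤ ‖∑ i, gradient (f i) z‖ := by
  apply mul_norm_le_norm_of_le_inner
  have hmono := Finset.sum_le_sum fun i (_ : i ∈ Finset.univ) =>
    (hθbar i).le_inner_gradient_sub (hf i) hS hxsS hz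
  rwa [← Finset.sum_mul, ← sum_inner, Finset.sum_sub_distrib, hxs, sub_zero, real_inner_comm]
    at hmono

theorem norm_consensus (z : E n) : ‖consensus N z‖ = √(N : ℝ) * ‖z‖ := by
  rw [PiLp.norm_eq_of_L2]
  simp [consensus]

theorem norm_consensus_sub_le_errorBound {z : E n} (hN : 0 < N) (hf : ∀ i, ContDiff ℝ 2 (f i))
    (hxs : ∑ i, gradient (f i) xs = 0) (hV : 0 ≤ V f xs x0) (hθbar : ∀ i, 0 < θbar i)
    (hlower : ∀ i, HessLowerBound (f i) (convexHull ℝ (⋃ j, Cset f xs x0 j)) (θbar i))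
    (hz : ∀ i, z ∈ Cset f xs x0 i)
    (hgrad : ‖∑ i, gradient (f i) z‖ ≤
      (⨆ i, L i / rho G (V f xs x0) θ Θ L α i) / 2 * V f xs x0) :
    ‖consensus N z - consensus N xs‖ ≤ errorBound G (V f xs x0) θ Θ L θbar α := by
  have hsub : Cset f xs x0 ⟨0, hN⟩ ⊆ convexHull ℝ (⋃ j, Cset f xs x0 j) :=
    (Set.subset_iUnion _ _).trans (subset_convexHull ℝ _)
  have hsum : 0 < ∑ i, θbar i := Finset.sum_pos (fun i _ => hθbar i) ⟨⟨0, hN⟩, Finset.mem_univ _⟩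
  have hdist : ‖z - xs‖ ≤
      (⨆ i, L i / rho G (V f xs x0) θ Θ L α i) / 2 * V f xs x0 / ∑ i, θbar i :=
    (le_div_iff₀' hsum).mpr ((sum_mul_norm_sub_le_norm_sum_gradient hf (convex_convexHull ℝ _)
      hlower hxs (hsub (optimum_mem_Cset hV _)) (hsub (hz _))).trans hgrad)
  calc ‖consensus N z - consensus N xs‖ = √(N : ℝ) * ‖z - xs‖ := norm_consensus (z - xs)
    _ ≤ √(N : ℝ) * ((⨆ i, L i / rho G (V f xs x0) θ Θ L α i) / 2 * V f xs x0 / ∑ i, θbar i) := by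
        gcongr
    _ = errorBound G (V f xs x0) θ Θ L θbar α := by
        rw [errorBound]
        field_simp

end Optimality

section SmallSteps

variable {N : ℕ} {G : SimpleGraph (Fin N)} [DecidableRel G.Adj] {α : Sym2 (Fin N) → ℝ}
  {v0 : ℝ} {θ Θ L θbar : Fin N → ℝ}

theorem div_rho_le (hN : 2 ≤ N) (hG : G.Connected) (hα : ∀ e ∈ G.edgeSet, 0 < α e) {i : Fin N}
    (hθ : 0 < θ i) (hL : 0 ≤ L i)
    (hsmall : maxNeighborStep G α i * (4 * G.degree i * (Θ i + L i / 2 * √(2 * v0 / θ i))) ≤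
      θ i ^ 2) :
    L i / rho G v0 θ Θ L α i ≤ 4 * G.degree i * L i / θ i ^ 2 * maxNeighborStep G α i := by
  have hdeg := degree_pos hN hG i
  have hstep := maxNeighborStep_pos hN hG hα i
  have hsmall' : Θ i + L i / 2 * √(2 * v0 / θ i) ≤
      θ i ^ 2 / (4 * G.degree i * maxNeighborStep G α i) := by
    rw [le_div_iff₀ (by positivity)]
    linarith
  have hdouble : θ i ^ 2 / (2 * G.degree i * maxNeighborStep G α i) =
      2 * (θ i ^ 2 / (4 * G.degree i * maxNeighborStep G α i)) := by
    field_simp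
    norm_num
  have hrho : θ i ^ 2 / (4 * G.degree i * maxNeighborStep G α i) ≤ rho G v0 θ Θ L α i := by
    rw [rho_eq]
    linarith
  calc L i / rho G v0 θ Θ L α i ≤ L i / (θ i ^ 2 / (4 * G.degree i * maxNeighborStep G α i)) := by
        gcongr
    _ = _ := by field_simp

theorem exists_iSup_div_rho_le (hN : 2 ≤ N) (hG : G.Connected) (v0 : ℝ) (hθ : ∀ i, 0 < θ i)
    (hΘ : ∀ i, 0 < Θ i) (hL : ∀ i, 0 ≤ L i) :
    ∃ K ≥ 0, ∃ α₀ > 0, ∀ α : Sym2 (Fin N) → ℝ, (∀ e ∈ G.edgeSet, 0 < α e ∧ α e ≤ α₀) →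
      (⨆ i, L i / rho G v0 θ Θ L α i) ≤ K * alphaMax G α := by
  have : Nonempty (Fin N) := ⟨⟨0, by omega⟩⟩
  have hdeg : ∀ i, (0 : ℝ) < G.degree i := degree_pos hN hG
  have hden : ∀ i, 0 < 4 * G.degree i * (Θ i + L i / 2 * √(2 * v0 / θ i)) := fun i => by
    have := hdeg i
    have := hΘ i
    have := hL i
    positivity
  have hK : ∀ i, 0 ≤ 4 * G.degree i * L i / θ i ^ 2 := fun i => by
    have := hL i
    positivity
  obtain ⟨i₀, hi₀⟩ := exists_eq_ciInf_of_finite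
    (f := fun i => θ i ^ 2 / (4 * G.degree i * (Θ i + L i / 2 * √(2 * v0 / θ i))))
  refine ⟨⨆ i, 4 * G.degree i * L i / θ i ^ 2, Real.iSup_nonneg hK, _,
    hi₀ ▸ div_pos (pow_pos (hθ i₀) 2) (hden i₀), fun α hα => ciSup_le fun i => ?_⟩
  obtain ⟨j, hij, heq⟩ := exists_maxNeighborStep_eq hN hG α i
  have hsmall := (le_div_iff₀ (hden i)).mp
    (heq ▸ (hα _ hij).2.trans (ciInf_le (Set.finite_range _).bddBelow i))
  have hpos : ∀ e ∈ G.edgeSet, 0 < α e := fun e he => (hα e he).1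
  exact (div_rho_le hN hG hpos (hθ i) (hL i) hsmall).trans <|
    mul_le_mul (le_ciSup (f := fun i => 4 * G.degree i * L i / θ i ^ 2)
      (Set.finite_range _).bddAbove i) (maxNeighborStep_le_alphaMax hN hG i)
      (maxNeighborStep_pos hN hG hpos i).le (Real.iSup_nonneg hK)

theorem exists_errorBound_le (hN : 2 ≤ N) (hG : G.Connected) (hv0 : 0 ≤ v0) (hθ : ∀ i, 0 < θ i)
    (hΘ : ∀ i, 0 < Θ i) (hL : ∀ i, 0 ≤ L i) (hθbar : ∀ i, 0 ≤ θbar i) :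
    ∃ C > 0, ∃ α₀ > 0, ∀ α : Sym2 (Fin N) → ℝ, (∀ e ∈ G.edgeSet, 0 < α e ∧ α e ≤ α₀) →
      errorBound G v0 θ Θ L θbar α ≤ C * alphaMax G α := by
  obtain ⟨K, hK, α₀, hα₀, hbound⟩ := exists_iSup_div_rho_le hN hG v0 hθ hΘ hL
  have hW : 0 ≤ √(N : ℝ) * v0 / (2 * ∑ i, θbar i) :=
    div_nonneg (by positivity) (mul_nonneg zero_le_two (Finset.sum_nonneg fun i _ => hθbar i))
  set W := √(N : ℝ) * v0 / (2 * ∑ i, θbar i)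
  refine ⟨K * W + 1, by positivity, α₀, hα₀, fun α hα => ?_⟩
  have hmax := alphaMax_pos hN hG fun e he => (hα e he).1
  calc errorBound G v0 θ Θ L θbar α ≤ K * alphaMax G α * W :=
        mul_le_mul_of_nonneg_right (hbound α hα) hW
    _ ≤ (K * W + 1) * alphaMax G α := by linarith

end SmallSteps

section Iterates

variable {N n : ℕ} {G : SimpleGraph (Fin N)} [DecidableRel G.Adj] {α : Sym2 (Fin N) → ℝ}
  {f : Fin N → E n → ℝ} {xs : E n} {x0 : Stack N n} {θ Θ' L' : Fin N → ℝ} {αbar : ℝ}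

theorem isUpdate_iterate (hθ : ∀ i, 0 < θ i)
    (hlower : ∀ i, HessLowerBound (f i) (convexHull ℝ (Cset f xs x0 i)) (θ i)) {k : ℕ}
    (hmem : ∀ i, iterate G f (quadSurrogate N n) α x0 k i ∈ Cset f xs x0 i) :
    IsUpdate G f α (iterate G f (quadSurrogate N n) α x0 k)
      (iterate G f (quadSurrogate N n) α x0 (k + 1)) :=
  isUpdate_step hθ fun i => hlower i _ (subset_convexHull ℝ _ (hmem i))

theorem iterate_mem_Cset (hN : 2 ≤ N) (hG : G.Connected) (hα : ∀ e ∈ G.edgeSet, 0 < α e)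
    (hαbar : ∀ e ∈ G.edgeSet, α e ≤ αbar) (hdrop : StepSizeDrop G (V f xs x0) θ θ Θ' L' α)
    (hconv : ∀ i, ConvexOn ℝ Set.univ (f i)) (hf : ∀ i, ContDiff ℝ 2 (f i)) (hθ : ∀ i, 0 < θ i)
    (hlower : ∀ i, HessLowerBound (f i) (convexHull ℝ (Cset f xs x0 i)) (θ i))
    (hθΘ' : ∀ i, θ i ≤ Θ' i) (hΘ' : ∀ i, HessUpperBound (f i) (Cset' G f xs x0 αbar θ i) (Θ' i))
    (hL0 : ∀ i, 0 ≤ L' i) (hL' : ∀ i, HessLipschitz (f i) (Cset' G f xs x0 αbar θ i) (L' i))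
    (k : ℕ) (i : Fin N) : iterate G f (quadSurrogate N n) α x0 k i ∈ Cset f xs x0 i := by
  have hdiff : ∀ i, Differentiable ℝ (f i) := fun i => (hf i).differentiable two_ne_zero
  suffices hV : ∀ k, V f xs (iterate G f (quadSurrogate N n) α x0 k) ≤ V f xs x0 from
    mem_Cset_of_V_le hconv hdiff (hV k) i
  intro k
  induction k with
  | zero => rfl
  | succ k ih =>
    have hmem := mem_Cset_of_V_le hconv hdiff ih
    exact ((isUpdate_iterate hθ hlower hmem).V_le_of_stepSizeDrop hN hG hα hαbar hdrop hf
      (V_nonneg hconv hdiff xs x0) hθ hlower hθΘ' hΘ' hL0 hL' hmem).trans ih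

end Iterates

end DEAN

theorem theorem3_general {N n : ℕ} (hN : 2 ≤ N) (hn : 1 ≤ n)
    (G : SimpleGraph (Fin N)) [DecidableRel G.Adj] (hG : G.Connected)
    (f : Fin N → DEAN.E n → ℝ) (hf : ∀ i, ContDiff ℝ 2 (f i))
    (hconv : ∀ i, ConvexOn ℝ Set.univ (f i))
    (xs : DEAN.E n) (hxs : IsMinOn (fun x => ∑ i, f i x) Set.univ xs)
    (x0 : DEAN.Stack N n) (hx0 : ∑ i, gradient (f i) (x0 i) = 0)
    (αbar : ℝ) (θ Θ L θ' Θ' L' θbar : Fin N → ℝ)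
    (hθ : ∀ i, 0 < θ i ∧ DEAN.HessLowerBound (f i) (convexHull ℝ (DEAN.Cset f xs x0 i)) (θ i))
    (hΘ : ∀ i, DEAN.HessUpperBound (f i) (convexHull ℝ (DEAN.Cset f xs x0 i)) (Θ i))
    (hL : ∀ i, 0 ≤ L i ∧ DEAN.HessLipschitz (f i) (convexHull ℝ (DEAN.Cset f xs x0 i)) (L i))
    (hΘ' : ∀ i, DEAN.HessUpperBound (f i) (DEAN.Cset' G f xs x0 αbar θ i) (Θ' i))
    (hL' : ∀ i, DEAN.HessLipschitz (f i) (DEAN.Cset' G f xs x0 αbar θ i) (L' i))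
    (hmono : ∀ i, θ' i ≤ θ i ∧ Θ i ≤ Θ' i ∧ L i ≤ L' i)
    (hθbar : ∀ i, 0 < θbar i ∧
      DEAN.HessLowerBound (f i) (convexHull ℝ (⋃ j, DEAN.Cset f xs x0 j)) (θbar i)) :
    (∀ α : Sym2 (Fin N) → ℝ,
      (∀ e ∈ G.edgeSet, 0 < α e ∧ α e ≤ αbar) →
      DEAN.StepSizeDrop G (DEAN.V f xs x0) θ θ' Θ' L' α →
      (∀ e ∈ G.edgeSet, α e < (⨅ i, θ i) / (G.maxDegree : ℝ)) →
      (0 ≤ DEAN.rate hN G θ Θ α ∧ DEAN.rate hN G θ Θ α < 1 ∧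
        (DEAN.rate hN G θ Θ α = 0 →
          G = ⊤ ∧ (⨅ i, θ i) = (⨆ i, Θ i) ∧ ∀ e ∈ G.edgeSet, α e = (⨅ i, θ i) / N)) ∧
      (∀ i, 0 < DEAN.rho G (DEAN.V f xs x0) θ Θ L α i) ∧
      ∃ xt : DEAN.E n,
        (∀ k, ‖DEAN.iterate G f (DEAN.quadSurrogate N n) α x0 k - DEAN.consensus N xt‖ ≤
          DEAN.alphaMax G α * DEAN.lamMax hN G / ((⨅ i, θ i) * (1 - DEAN.rate hN G θ Θ α))
            * ‖x0‖ * DEAN.rate hN G θ Θ α ^ k) ∧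
        ‖DEAN.consensus N xt - DEAN.consensus N xs‖ ≤
          DEAN.errorBound G (DEAN.V f xs x0) θ Θ L θbar α) ∧
    (∃ C > 0, ∃ α₀ > 0, ∀ α : Sym2 (Fin N) → ℝ,
      (∀ e ∈ G.edgeSet, 0 < α e ∧ α e ≤ α₀) →
      DEAN.errorBound G (DEAN.V f xs x0) θ Θ L θbar α ≤ C * DEAN.alphaMax G α) := by
  have : Nonempty (Fin N) := ⟨⟨0, by omega⟩⟩
  choose hθ0 hlower using hθ
  choose hL0 hLip using hL
  choose hθ' hΘΘ' hLL' using hmono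
  choose hθbar0 hbar using hθbar
  have hdiff : ∀ i, Differentiable ℝ (f i) := fun i => (hf i).differentiable two_ne_zero
  have hV := DEAN.V_nonneg hconv hdiff xs
  have hθΘ : ∀ i, θ i ≤ Θ i := fun i => (hlower i).le_of_hessUpperBound (hΘ i) hn
    (subset_convexHull ℝ _ (DEAN.optimum_mem_Cset (hV x0) i))
  have hinf : 0 < ⨅ i, θ i := DEAN.iInf_pos_of_forall_pos hθ0
  have hinf_sup : (⨅ i, θ i) ≤ ⨆ i, Θ i := DEAN.iInf_le_iSup_of_forall_le hθΘ
  refine ⟨fun α hα hdrop hαθ => ?_, DEAN.exists_errorBound_le hN hG (hV x0) hθ0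
    (fun i => (hθ0 i).trans_le (hθΘ i)) hL0 fun i => (hθbar0 i).le⟩
  have hpos : ∀ e ∈ G.edgeSet, 0 < α e := fun e he => (hα e he).1
  have hθΘ' : ∀ i, θ i ≤ Θ' i := fun i => (hθΘ i).trans (hΘΘ' i)
  have hL0' : ∀ i, 0 ≤ L' i := fun i => (hL0 i).trans (hLL' i)
  have hdrop' := hdrop.mono hθ' fun i => DEAN.sub_half_add_pos (hθ0 i) (hθΘ' i) (hL0' i)
  have hmem := DEAN.iterate_mem_Cset hN hG hpos (fun e he => (hα e he).2) hdrop' hconv hf hθ0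
    hlower hθΘ' hΘ' hL0' hL'
  have hupdate := fun k => DEAN.isUpdate_iterate hθ0 hlower (hmem k)
  have hρ : ∀ i, 0 < DEAN.rho G (DEAN.V f xs x0) θ Θ L α i := fun i =>
    DEAN.rho_pos hN hG hpos hdrop' (hθ0 i) (hθΘ i) (hΘΘ' i) (hL0 i) (hLL' i)
  have hrate0 := DEAN.rate_nonneg hN hG hpos hinf hinf_sup
  have hrate1 := DEAN.rate_lt_one hN hG hpos hinf (hinf.trans_le hinf_sup) hαθ
  obtain ⟨z, hz, hconvergence⟩ := DEAN.exists_tendsto_consensus_of_isUpdate hupdate hN hG hpos hf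
    hinf (hinf.trans_le hinf_sup) (fun k i => hlower i _ (subset_convexHull ℝ _ (hmem k i)))
    (fun k i => hΘ i _ (subset_convexHull ℝ _ (hmem k i))) hrate0 hrate1
  have hgradient := DEAN.norm_sum_gradient_le_of_tendsto hz hf hx0
    (div_nonneg (Real.iSup_nonneg fun i => div_nonneg (hL0 i) (hρ i).le) zero_le_two)
    (fun k => hV _) fun k => (hupdate k).norm_sum_gradient_sub_le_mul_V_sub hN hG hpos hf (hV x0)
      hθ0 hlower hθΘ hΘ hL0 hLip hρ (hmem k) (hmem (k + 1))
  exact ⟨⟨hrate0, hrate1, DEAN.eq_top_of_rate_eq_zero hN hG hpos hinf hinf_sup⟩, hρ, z,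
    hconvergence, DEAN.norm_consensus_sub_le_errorBound (by omega) hf
      (DEAN.sum_gradient_eq_zero_of_isMinOn hdiff hxs) (hV x0) hθbar0 hbar
      (fun i => DEAN.mem_Cset_of_tendsto hz (hf i) fun k => hmem k i) hgradient⟩

theorem theorem3 {N n : ℕ} (hN : 2 ≤ N) (hn : 1 ≤ n)
    (G : SimpleGraph (Fin N)) [DecidableRel G.Adj] (hG : G.Connected)
    (f : Fin N → DEAN.E n → ℝ) (hf : ∀ i, DEAN.ObjectiveAssumption (f i))
    -- the optimal solution of the network problem
    (xs : DEAN.E n) (hxs : IsMinOn (fun x => ∑ i, f i x) Set.univ xs)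
    (hcoercive : ∀ i, Filter.Tendsto (DEAN.bregman (f i) xs)
      (Filter.cocompact (DEAN.E n)) Filter.atTop)
    -- the initial state: every node starts at the minimizer of its own objective
    (x0 : DEAN.Stack N n) (hx0 : ∀ i, IsMinOn (f i) Set.univ (x0 i))
    (αbar : ℝ) (hαbar : 0 < αbar)
    (θ Θ L θ' Θ' L' θbar : Fin N → ℝ)
    -- curvature constants on `conv C_i`
    (hθ : ∀ i, 0 < θ i ∧ DEAN.HessLowerBound (f i) (convexHull ℝ (DEAN.Cset f xs x0 i)) (θ i))
    (hΘ : ∀ i, 0 < Θ i ∧ DEAN.HessUpperBound (f i) (convexHull ℝ (DEAN.Cset f xs x0 i)) (Θ i))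
    (hL : ∀ i, 0 ≤ L i ∧ DEAN.HessLipschitz (f i) (convexHull ℝ (DEAN.Cset f xs x0 i)) (L i))
    -- curvature constants on `C'_i`
    (hθ' : ∀ i, 0 < θ' i ∧ DEAN.HessLowerBound (f i) (DEAN.Cset' G f xs x0 αbar θ i) (θ' i))
    (hΘ' : ∀ i, 0 < Θ' i ∧ DEAN.HessUpperBound (f i) (DEAN.Cset' G f xs x0 αbar θ i) (Θ' i))
    (hL' : ∀ i, 0 ≤ L' i ∧ DEAN.HessLipschitz (f i) (DEAN.Cset' G f xs x0 αbar θ i) (L' i))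
    (hmono : ∀ i, θ' i ≤ θ i ∧ Θ i ≤ Θ' i ∧ L i ≤ L' i)
    -- convexity parameters on `conv (⋃ j, C_j)`
    (hθbar : ∀ i, 0 < θbar i ∧
      DEAN.HessLowerBound (f i) (convexHull ℝ (⋃ j, DEAN.Cset f xs x0 j)) (θbar i)) :
    (∀ α : Sym2 (Fin N) → ℝ,
      (∀ e ∈ G.edgeSet, 0 < α e ∧ α e ≤ αbar) →
      DEAN.StepSizeDrop G (DEAN.V f xs x0) θ θ' Θ' L' α →
      (∀ e ∈ G.edgeSet, α e < (⨅ i, θ i) / (G.maxDegree : ℝ)) →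
      -- the rate lies in `[0, 1)`, and is positive outside one degenerate configuration
      (0 ≤ DEAN.rate hN G θ Θ α ∧ DEAN.rate hN G θ Θ α < 1 ∧
        (DEAN.rate hN G θ Θ α = 0 →
          G = ⊤ ∧ (⨅ i, θ i) = (⨆ i, Θ i) ∧ ∀ e ∈ G.edgeSet, α e = (⨅ i, θ i) / N)) ∧
      (∀ i, 0 < DEAN.rho G (DEAN.V f xs x0) θ Θ L α i) ∧
      ∃ xt : DEAN.E n,
        (∀ k, ‖DEAN.iterate G f (DEAN.quadSurrogate N n) α x0 k - DEAN.consensus N xt‖ ≤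
          DEAN.alphaMax G α * DEAN.lamMax hN G / ((⨅ i, θ i) * (1 - DEAN.rate hN G θ Θ α))
            * ‖x0‖ * DEAN.rate hN G θ Θ α ^ k) ∧
        ‖DEAN.consensus N xt - DEAN.consensus N xs‖ ≤
          DEAN.errorBound G (DEAN.V f xs x0) θ Θ L θbar α) ∧
    -- the error bound is `O(max α)` as the step sizes tend to zero
    (∃ C > 0, ∃ α₀ > 0, ∀ α : Sym2 (Fin N) → ℝ,
      (∀ e ∈ G.edgeSet, 0 < α e ∧ α e ≤ α₀) →
      DEAN.errorBound G (DEAN.V f xs x0) θ Θ L θbar α ≤ C * DEAN.alphaMax G α) :=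
  theorem3_general hN hn G hG f (fun i => (hf i).contDiff)
    (fun i => (hf i).stronglyConvex.convexOn (hf i).contDiff) xs hxs x0
    (Finset.sum_eq_zero fun i _ => DEAN.gradient_eq_zero_of_isMinOn (hx0 i)) αbar θ Θ L θ' Θ' L'
    θbar hθ (fun i => (hΘ i).2) hL (fun i => (hΘ' i).2) (fun i => (hL' i).2) hmono hθbar
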